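/- Let $D$ range over the finite relational databases over a fixed relational vocabulary $\mathrm{edb}$, and let $\mathrm{DOM}$ be the unary relation holding all constants that occur in $D$. Call an expression of relational algebra $q$-free if it is built from relation names (whose columns are given attribute names, possibly with selection for repeated names or for constants), powers of $\mathrm{DOM}$, selections by Boolean combinations of equalities, renamings, natural joins and equi-joins, unions, intersections and differences; that is, if it contains no projection other than the merging of equated columns and the dropping of a column of a relation name that is fixed to a constant. Let $s$ be a positive integer, let $Q$ be a new relation name of arity $s$, and let $\mathrm{PHI}$ be a $q$-free expression over the vocabulary $\mathrm{edb}(D)\cup\{Q\}$ in which no constant occurs as an argument of $Q$, and whose attributes are exactly two distinct names $Y_1,Y_2$. Consider the NP-Alg query $$\text{Guess } Q^{(s)};\qquad \mathrm{FAIL} = (\mathrm{DOM}\times\mathrm{DOM}) - \pi_{Y_1,Y_2}(\mathrm{PHI}),$$ whose answer on $D$ is "yes" if there is an extension $Q\subseteq \mathrm{DOM}^s$ for which $\mathrm{FAIL}=\emptyset$, and "no" otherwise. For every fixed such query, the answer can be computed (by a deterministic Turing machine) in time polynomial in the size of the database $D$. -/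

import Mathlib

namespace NPAlg

/-- Constants that may occur in databases and queries. -/
abbrev Const := ℕ

/-- Attribute names. -/
abbrev Attr := String

/-- A relational vocabulary: finitely many relation names, each with an arity. -/
structure Schema where
  numRel : ℕ
  arity : Fin numRel → ℕ

/-- A finite relational database over the vocabulary `R`. -/
abbrev Database (R : Schema) : Type := ∀ r : Fin R.numRel, Finset (Fin (R.arity r) → Const)

/-- `DOM`: the set of all constants that occur in the database. -/
def Database.dom {R : Schema} (D : Database R) : Set Const :=
  {c | ∃ r, ∃ t ∈ D r, ∃ i, t i = c}

/-- Selection conditions over the attribute set `U`: Boolean combinations of equalities between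
attributes and constants. -/
inductive Cond (U : Finset Attr) : Type
  | eq : (U ⊕ Const) → (U ⊕ Const) → Cond U
  | not : Cond U → Cond U
  | and : Cond U → Cond U → Cond U
  | or : Cond U → Cond U → Cond U

/-- The value of a term (an attribute or a constant) on a tuple. -/
def termVal {U : Finset Attr} (t : U → Const) : U ⊕ Const → Const := Sum.elim t id

/-- Truth of a selection condition on a tuple. -/
def Cond.Holds {U : Finset Attr} (t : U → Const) : Cond U → Prop
  | .eq x y => termVal t x = termVal t y
  | .not c => ¬ c.Holds t
  | .and c d => c.Holds t ∧ d.Holds t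
  | .or c d => c.Holds t ∨ d.Holds t

/-- Expressions of (named) relational algebra over relation names `ι` with arities `ar`, indexed by
the set of attributes of the result. -/
inductive RAExpr {ι : Type} (ar : ι → ℕ) : Finset Attr → Type
  /-- A relation whose columns are given attribute names. As in the translation of an atomic
  formula, a name may be repeated (the tuples on which the columns agree are selected, and the
  columns merged), and a column may be fixed to a constant (and dropped). -/
  | rel {U : Finset Attr} (r : ι) (args : Fin (ar r) → U ⊕ Const)
      (hargs : ∀ a : U, ∃ i, args i = Sum.inl a) : RAExpr ar U
  /-- `DOM ^ |U|`, with columns named by `U`. -/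
  | dom (U : Finset Attr) : RAExpr ar U
  /-- selection -/
  | select {U : Finset Attr} (c : Cond U) (E : RAExpr ar U) : RAExpr ar U
  /-- projection onto `V` -/
  | project {U : Finset Attr} (V : Finset Attr) (hV : V ⊆ U) (E : RAExpr ar U) : RAExpr ar V
  /-- renaming of columns -/
  | rename {U V : Finset Attr} (f : U ≃ V) (E : RAExpr ar U) : RAExpr ar V
  /-- natural join (the Cartesian product, if there are no common attributes) -/
  | join {U V : Finset Attr} (E : RAExpr ar U) (F : RAExpr ar V) : RAExpr ar (U ∪ V)
  /-- equi-join: every column `b` of `F` either is merged with a column `m b` of `E`, to which it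
  is equated, or keeps its own name `m b = b`. -/
  | equijoin {U V : Finset Attr} (E : RAExpr ar U) (F : RAExpr ar V) (m : V → Attr)
      (hm : ∀ b : V, m b ∈ U ∨ m b = b) : RAExpr ar (U ∪ Finset.univ.image m)
  | union {U : Finset Attr} (E F : RAExpr ar U) : RAExpr ar U
  | inter {U : Finset Attr} (E F : RAExpr ar U) : RAExpr ar U
  | diff {U : Finset Attr} (E F : RAExpr ar U) : RAExpr ar U

namespace RAExpr

variable {ι : Type} {ar : ι → ℕ}

/-- The value of an expression: a set of tuples over its attributes, where `I` interprets the
relation names and `A` is the extension of `DOM`. -/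
def eval (I : ∀ r, Set (Fin (ar r) → Const)) (A : Set Const) :
    {U : Finset Attr} → RAExpr ar U → Set (U → Const)
  | _, rel r args _ => {t | (fun i => termVal t (args i)) ∈ I r}
  | _, dom _ => {t | ∀ a, t a ∈ A}
  | _, select c E => {t | t ∈ E.eval I A ∧ c.Holds t}
  | _, project _ hV E => {t | ∃ u ∈ E.eval I A, ∀ a, t a = u ⟨a.1, hV a.2⟩}
  | _, rename f E => {t | (fun a => t (f a)) ∈ E.eval I A}
  | _, join E F =>
      {t | (fun a => t ⟨a.1, Finset.mem_union_left _ a.2⟩) ∈ E.eval I A ∧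
        (fun b => t ⟨b.1, Finset.mem_union_right _ b.2⟩) ∈ F.eval I A}
  | _, equijoin E F m _ =>
      {t | (fun a => t ⟨a.1, Finset.mem_union_left _ a.2⟩) ∈ E.eval I A ∧
        (fun b => t ⟨m b, Finset.mem_union_right _
          (Finset.mem_image_of_mem m (Finset.mem_univ b))⟩) ∈ F.eval I A}
  | _, union E F => E.eval I A ∪ F.eval I A
  | _, inter E F => E.eval I A ∩ F.eval I A
  | _, diff E F => E.eval I A \ F.eval I A

/-- An expression is `q`-free if it does not contain the projection operator (apart from the merging
of equated columns). -/
def QFree : {U : Finset Attr} → RAExpr ar U → Prop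
  | _, rel _ _ _ => True
  | _, dom _ => True
  | _, select _ E => E.QFree
  | _, project _ _ _ => False
  | _, rename _ E => E.QFree
  | _, join E F => E.QFree ∧ F.QFree
  | _, equijoin E F _ _ => E.QFree ∧ F.QFree
  | _, union E F => E.QFree ∧ F.QFree
  | _, inter E F => E.QFree ∧ F.QFree
  | _, diff E F => E.QFree ∧ F.QFree

/-- No constant is an argument of an occurrence of a relation name in `S`. -/
def NoConstArgs (S : Set ι) : {U : Finset Attr} → RAExpr ar U → Prop
  | _, rel r args _ => r ∈ S → ∀ i, (args i).isLeft
  | _, dom _ => True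
  | _, select _ E => E.NoConstArgs S
  | _, project _ _ E => E.NoConstArgs S
  | _, rename _ E => E.NoConstArgs S
  | _, join E F => E.NoConstArgs S ∧ F.NoConstArgs S
  | _, equijoin E F _ _ => E.NoConstArgs S ∧ F.NoConstArgs S
  | _, union E F => E.NoConstArgs S ∧ F.NoConstArgs S
  | _, inter E F => E.NoConstArgs S ∧ F.NoConstArgs S
  | _, diff E F => E.NoConstArgs S ∧ F.NoConstArgs S

end RAExpr

/-- The vocabulary `edb(D) ∪ Q`, the two parts being disjoint. -/
abbrev vocab (R Q : Schema) : Fin R.numRel ⊕ Fin Q.numRel → ℕ := Sum.elim R.arity Q.arity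

/-- A (Boolean) `NP-Alg` query over databases with vocabulary `R`: guess the relations of `guess`,
and compute `FAIL` by an expression of relational algebra. -/
structure Query (R : Schema) where
  guess : Schema
  attrs : Finset Attr
  fail : RAExpr (vocab R guess) attrs

/-- The interpretation of `edb(D) ∪ Q` by the database and an extension of the guessed relations. -/
def interp {R Q : Schema} (D : Database R) (ext : ∀ q, Set (Fin (Q.arity q) → Const)) :
    ∀ r, Set (Fin (vocab R Q r) → Const)
  | Sum.inl r => {t | t ∈ D r}
  | Sum.inr q => ext q

/-- The answer to the query on `D` is "yes": some extension of the guessed relations with elements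
in `DOM` makes `FAIL` empty. -/
def Query.Holds {R : Schema} (ψ : Query R) (D : Database R) : Prop :=
  ∃ ext : ∀ q, Set (Fin (ψ.guess.arity q) → Const),
    (∀ q, ∀ t ∈ ext q, ∀ i, t i ∈ D.dom) ∧ ψ.fail.eval (interp D ext) D.dom = ∅

/-- The vocabulary with a single relation name, of arity `s`. -/
abbrev single (s : ℕ) : Schema := ⟨1, fun _ => s⟩

/-- The query `Guess Q⁽ˢ⁾; FAIL = (DOM × DOM) - π_{Y₁,Y₂}(PHI)`. -/
abbrev pairQuery {R : Schema} {s : ℕ} {U : Finset Attr} (Y₁ Y₂ : Attr)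
    (h₁ : Y₁ ∈ U) (h₂ : Y₂ ∈ U) (PHI : RAExpr (vocab R (single s)) U) : Query R where
  guess := single s
  attrs := {Y₁} ∪ {Y₂}
  fail := .diff (.join (.dom {Y₁}) (.dom {Y₂}))
    (.project ({Y₁} ∪ {Y₂})
      (Finset.union_subset (Finset.singleton_subset_iff.2 h₁) (Finset.singleton_subset_iff.2 h₂))
      PHI)

/-! Databases as inputs of Turing machines -/

/-- A listing of a database: for each relation its tuples, in any order (repetitions allowed). -/
abbrev Listing (R : Schema) : Type := ∀ r : Fin R.numRel, List (Fin (R.arity r) → Const)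

/-- The database that is listed. -/
def Listing.toDatabase {R : Schema} (L : Listing R) : Database R := fun r => (L r).toFinset

open Computability in
/-- A tuple is written as a bracketed sequence of constants, each in binary and followed by a
comma. -/
def encodeTuple {k : ℕ} (t : Fin k → Const) : List Γ' :=
  Γ'.bra :: ((List.ofFn t).flatMap fun c => encodingNatΓ'.encode c ++ [Γ'.comma]) ++ [Γ'.ket]

open Computability in
/-- A database is written relation by relation, each as a bracketed sequence of tuples. -/
def Listing.encode {R : Schema} (L : Listing R) : List Γ' :=
  (List.finRange R.numRel).flatMap fun r => Γ'.bra :: (L r).flatMap encodeTuple ++ [Γ'.ket]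

open Classical in
/-- The answer to the query on a listed database. -/
noncomputable def Query.answer {R : Schema} (ψ : Query R) (L : Listing R) : Bool :=
  decide (ψ.Holds L.toDatabase)

/-- The query can be evaluated in time polynomial in the size of the database (the query being
fixed): some Turing machine computes the answer in polynomial time. -/
def Query.PolyTime {R : Schema} (ψ : Query R) : Prop :=
  Nonempty (Turing.TM2ComputableInPolyTime (Listing.encode (R := R)) Computability.encodeBool
    ψ.answer)

end NPAlg

namespace NPAlg
open Computability Turing

/-! Since `PHI` has only the attributes `Y₁`, `Y₂` and no projection, it is a quantifier-free
formula `φ` in two variables (`RAExpr.exists_fm`), and the query asks for a `Q` such that `φ` holds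
at every pair of elements of `DOM` (`exists_fm_holds`). No constant is an argument of `Q`, so at
`(a, b)` the formula inspects only tuples of `Q` with entries in `{a, b}`. A tuple in which both of
`a ≠ b` occur is inspected at `(a, b)` and `(b, a)` only; different unordered pairs share nothing
but the constant tuples `(a, …, a)`. Guessing `Q` therefore amounts to choosing a Boolean `v a` for
each constant, subject to binary constraints: for `a ≠ b`, the values `v a`, `v b` must extend to
truth values at all tuples over `{a, b}` that make `φ` true at both `(a, b)` and `(b, a)`
(`exists_ext_iff`).

A system of binary constraints on Boolean variables is an instance of 2-SAT. It is solved by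
eliminating one variable after another, each time composing the constraints through the eliminated
variable; this is sound because the domain has only two values (`solve_iff`).

For fixed `φ`, the constraint for `(a, b)` depends on a bounded amount of information about the
database, which a finite automaton collects in one pass over the text if it is told which constants
equal `a` or `b` (`entry_recorder`, `agree_record`). A machine with several stacks runs this
automaton for all pairs of occurrences of constants, writes the constraints as a matrix and
eliminates variables in it, in polynomial time (`reach_all`). Several occurrences of one constant
give several variables, which does no harm (`solve_matrix`). -/

/-- A binary Boolean constraint. -/
abbrev BoolRel : Type := Bool → Bool → Bool

/-- The constraint on the second and third variable that is obtained from a constraint `x` on them,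
and from constraints `m`, `l` and `r` on the first variable alone and together with the second and
the third, by eliminating the first variable. -/
def eliminate (m l x r : BoolRel) : BoolRel := fun p q =>
  x p q && ((l p true && m true true && r true q) || (l p false && m false false && r false q))

/-! ### The machine: stacks, internal states and program. -/

/-- A finite automaton that reads the symbols of a database, and that is told for each constant
whether it is equal to each of two given ones. -/
structure Scanner (S : Type) where
  start : S
  sym : S → Γ' → S
  num : S → Bool → Bool → S
  out : S → BoolRel

/-- Stacks that hold input symbols. -/
inductive TextStack
  | inp | a | a' | b | b' | c | c' | u | u' | w | w'
  deriving DecidableEq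

instance : Fintype TextStack where
  elems := {.inp, .a, .a', .b, .b', .c, .c', .u, .u', .w, .w'}
  complete x := by cases x <;> decide

/-- Stacks that hold the rows of a matrix of constraints, separated by `none`. -/
inductive MatStack
  | m | m' | r | r'
  deriving DecidableEq

instance : Fintype MatStack where
  elems := {.m, .m', .r, .r'}
  complete x := by cases x <;> decide

/-- The stacks of the machine. -/
abbrev Stack : Type := TextStack ⊕ MatStack ⊕ Unit

/-- The stack alphabets of the machine. -/
abbrev StackSym : Stack → Type
  | .inl _ => Γ'
  | .inr (.inl _) => Option BoolRel
  | .inr (.inr _) => Bool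

/-- The internal states of the machine. -/
structure Regs (S : Type) where
  x : Option Γ' := none
  y : Option Γ' := none
  z : Option Γ' := none
  e : Option (Option BoolRel) := none
  f : Option (Option BoolRel) := none
  p : Bool := true
  q : Bool := true
  d : S
  m₀ : BoolRel := fun _ _ => false
  l₀ : BoolRel := fun _ _ => false
  ans : Bool := false

/-- The labels of the machine. -/
inductive Label
  | copyIn | rewA | rewB₀ | rewC₀ | getU | restU₀ | getW | restU | restW | scan | rewC | clrW
  | rewB | clrU | elim | loadR | rowHead | restR | zipR | rewM | clrR | clrB | clrC | clrM | fin
  deriving DecidableEq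

instance : Fintype Label where
  elems :=
    {.copyIn, .rewA, .rewB₀, .rewC₀, .getU, .restU₀, .getW, .restU, .restW, .scan, .rewC, .clrW,
      .rewB, .clrU, .elim, .loadR, .rowHead, .restR, .zipR, .rewM, .clrR, .clrB, .clrC, .clrM, .fin}
  complete x := by cases x <;> decide

/-- Statements of the machine. -/
abbrev MStmt (S : Type) : Type := TM2.Stmt StackSym Label (Regs S)

/-- Forget the symbols that have been read. -/
def Regs.clear {S : Type} (v : Regs S) : Regs S :=
  { v with x := none, y := none, z := none, e := none, f := none }

section Statements

variable {S : Type}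
open TM2.Stmt

/-- Go to a label. -/
def jump (l : Label) : MStmt S := load Regs.clear (goto fun _ => l)

/-- Push the symbol `x` on text stacks. -/
def pushText : List TextStack → MStmt S → MStmt S
  | [], k => k
  | i :: is, k => push (.inl i) (fun v => v.x.getD .blank) (pushText is k)

/-- Loop at `l`: move the symbols of a text stack to other ones, then go to `l'`. -/
def moveText (i : TextStack) (is : List TextStack) (l l' : Label) : MStmt S :=
  pop (.inl i) (fun v o => { v with x := o }) <|
    branch (fun v => v.x.isSome) (pushText is (jump l)) (jump l')

/-- Push the symbol `e` on matrix stacks. -/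
def pushMat : List MatStack → MStmt S → MStmt S
  | [], k => k
  | i :: is, k => push (.inr (.inl i)) (fun v => v.e.getD none) (pushMat is k)

/-- Loop at `l`: move the symbols of a matrix stack to other ones, then go to `l'`. -/
def moveMat (i : MatStack) (is : List MatStack) (l l' : Label) : MStmt S :=
  pop (.inr (.inl i)) (fun v o => { v with e := o }) <|
    branch (fun v => v.e.isSome) (pushMat is (jump l)) (jump l')

/-- Is the symbol a bit? -/
def isBit : Option Γ' → Bool
  | some (.bit _) => true
  | _ => false

/-- The program of the machine. -/
def prog (A : Scanner S) : Label → MStmt S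
  | .copyIn => moveText .inp [.a', .b', .c'] .copyIn .rewA
  | .rewA => moveText .a' [.a] .rewA .rewB₀
  | .rewB₀ => moveText .b' [.b] .rewB₀ .rewC₀
  | .rewC₀ => moveText .c' [.c] .rewC₀ .getU
  | .getU =>
    pop (.inl .a) (fun v o => { v with x := o }) <|
    branch (fun v => v.x.isNone) (jump .elim) <|
    branch (fun v => isBit v.x) (pushText [.u'] (jump .getU)) <|
    -- The separator is pushed before the entries of the row, so it lies below them and ends the row
    -- when the stack is read.
    branch (fun v => v.x == some .comma) (push (.inr (.inl .m)) (fun _ => none) (jump .restU₀))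
      (jump .getU)
  | .restU₀ => moveText .u' [.u] .restU₀ .getW
  | .getW =>
    pop (.inl .b) (fun v o => { v with x := o }) <|
    branch (fun v => v.x.isNone) (jump .rewB) <|
    pushText [.b'] <|
    branch (fun v => isBit v.x) (pushText [.w'] (jump .getW)) <|
    branch (fun v => v.x == some .comma) (jump .restU) (jump .getW)
  | .restU => moveText .u' [.u] .restU .restW
  | .restW => moveText .w' [.w] .restW .scan
  | .scan =>
    pop (.inl .c) (fun v o => { v with x := o }) <|
    branch (fun v => v.x.isNone)
      (push (.inr (.inl .m)) (fun v => some (A.out v.d)) <|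
        load (fun v => { v with d := A.start }) <| jump .rewC) <|
    pushText [.c'] <|
    branch (fun v => isBit v.x)
      (pop (.inl .u) (fun v o => { v with y := o }) <|
        pop (.inl .w) (fun v o => { v with z := o }) <|
        -- An exhausted reference constant yields `none`, which differs from the bit and falsifies
        -- the flag.
        load (fun v => { v with
          p := v.p && v.y == v.x, q := v.q && v.z == v.x, d := A.sym v.d (v.x.getD .blank) }) <|
        branch (fun v => v.y.isSome)
          (push (.inl .u') (fun v => v.y.getD .blank) <|
            branch (fun v => v.z.isSome)
              (push (.inl .w') (fun v => v.z.getD .blank) (jump .scan)) (jump .scan))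
          (branch (fun v => v.z.isSome)
            (push (.inl .w') (fun v => v.z.getD .blank) (jump .scan)) (jump .scan))) <|
    -- At the end of a constant, equality also requires that nothing of the reference constant
    -- remains.
    branch (fun v => v.x == some .comma)
      (peek (.inl .u) (fun v o => { v with y := o }) <|
        peek (.inl .w) (fun v o => { v with z := o }) <|
        load (fun v => { v with
          p := true, q := true, d := A.num v.d (v.p && v.y.isNone) (v.q && v.z.isNone) }) <|
        jump .restU)
      (load (fun v => { v with d := A.sym v.d (v.x.getD .blank) }) <| jump .scan)
  | .rewC => moveText .c' [.c] .rewC .clrW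
  | .clrW => moveText .w [] .clrW .getW
  | .rewB => moveText .b' [.b] .rewB .clrU
  | .clrU => moveText .u [] .clrU .getU
  | .elim =>
    pop (.inr (.inl .m)) (fun v o => { v with e := o }) <|
    branch (fun v => v.e.isNone) (load (fun v => { v with ans := true }) (jump .clrB)) <|
    load (fun v => { v with m₀ := (v.e.getD none).getD fun _ _ => false }) <|
    -- The constraint of a variable with itself matters only at equal arguments.
    branch (fun v => v.m₀ true true || v.m₀ false false) (jump .loadR)
      (load (fun v => { v with m₀ := fun _ _ => false }) (jump .clrB))
  | .loadR =>
    pop (.inr (.inl .m)) (fun v o => { v with e := o }) <|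
    -- The test fails both at a separator and on an empty stack.
    branch (fun v => (v.e.getD none).isSome) (pushMat [.r'] (jump .loadR)) (jump .rowHead)
  | .rowHead =>
    pop (.inr (.inl .m)) (fun v o => { v with e := o }) <|
    branch (fun v => v.e.isSome)
      (load (fun v => { v with l₀ := (v.e.getD none).getD fun _ _ => false }) (jump .restR))
      (load (fun v => { v with m₀ := fun _ _ => false }) (jump .rewM))
  | .restR => moveMat .r' [.r] .restR .zipR
  | .zipR =>
    pop (.inr (.inl .m)) (fun v o => { v with e := o }) <|
    branch (fun v => (v.e.getD none).isSome)
      (pop (.inr (.inl .r)) (fun v o => { v with f := o }) <|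
        push (.inr (.inl .r')) (fun v => v.f.getD none) <|
        push (.inr (.inl .m'))
          (fun v => some (eliminate v.m₀ v.l₀ ((v.e.getD none).getD fun _ _ => false)
            ((v.f.getD none).getD fun _ _ => false))) <|
        jump .zipR)
      (push (.inr (.inl .m')) (fun _ => none) <|
        load (fun v => { v with l₀ := fun _ _ => false }) (jump .rowHead))
  | .rewM => moveMat .m' [.m] .rewM .clrR
  | .clrR => moveMat .r' [] .clrR .elim
  -- A result counts only if the machine halts in its initial state with all stacks but the output
  -- empty; hence these clearing loops and the final reset of `ans`.
  | .clrB => moveText .b [] .clrB .clrC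
  | .clrC => moveText .c [] .clrC .clrM
  | .clrM => moveMat .m [] .clrM .fin
  | .fin => push (.inr (.inr ())) (fun v => v.ans) (load (fun v => { v with ans := false }) halt)

end Statements

/-! ### Configurations and timed runs. -/

/-- The contents of the stacks, and those components of the internal state that are kept from one
step to the next. -/
structure Conf {S : Type} (A : Scanner S) where
  inp : List Γ' := []
  a : List Γ' := []
  a' : List Γ' := []
  b : List Γ' := []
  b' : List Γ' := []
  c : List Γ' := []
  c' : List Γ' := []
  u : List Γ' := []
  u' : List Γ' := []
  w : List Γ' := []
  w' : List Γ' := []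
  m : List (Option BoolRel) := []
  m' : List (Option BoolRel) := []
  r : List (Option BoolRel) := []
  r' : List (Option BoolRel) := []
  out : List Bool := []
  p : Bool := true
  q : Bool := true
  d : S := A.start
  m₀ : BoolRel := fun _ _ => false
  l₀ : BoolRel := fun _ _ => false
  ans : Bool := false

section Runs

variable {S : Type} {A : Scanner S}

/-- The contents of the stacks. -/
def Conf.stk (x : Conf A) : ∀ k, List (StackSym k)
  | .inl .inp => x.inp
  | .inl .a => x.a
  | .inl .a' => x.a'
  | .inl .b => x.b
  | .inl .b' => x.b'
  | .inl .c => x.c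
  | .inl .c' => x.c'
  | .inl .u => x.u
  | .inl .u' => x.u'
  | .inl .w => x.w
  | .inl .w' => x.w'
  | .inr (.inl .m) => x.m
  | .inr (.inl .m') => x.m'
  | .inr (.inl .r) => x.r
  | .inr (.inl .r') => x.r'
  | .inr (.inr ()) => x.out

/-- The internal state. -/
def Conf.regs (x : Conf A) : Regs S where
  p := x.p
  q := x.q
  d := x.d
  m₀ := x.m₀
  l₀ := x.l₀
  ans := x.ans

/-- The configuration of the machine. -/
def Conf.cfg (l : Option Label) (x : Conf A) : TM2.Cfg StackSym Label (Regs S) :=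
  ⟨l, x.regs, x.stk⟩

/-- The machine comes from one configuration to another in at most `n` steps. -/
def Reach (A : Scanner S) (n : ℕ) (l : Label) (x : Conf A) (l' : Option Label) (y : Conf A) : Prop :=
  Nonempty (StateTransition.EvalsToInTime (TM2.step (prog A)) (x.cfg (some l)) (some (y.cfg l')) n)

/-- The stacks are compared one at a time, so that after a case split on the stack each comparison
closes by evaluation. -/
theorem Reach.step {l : Label} {x : Conf A} {l' : Option Label} {y : Conf A}
    (hl : (TM2.stepAux (prog A l) x.regs x.stk).l = l')
    (hv : (TM2.stepAux (prog A l) x.regs x.stk).var = y.regs)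
    (hs : ∀ k, (TM2.stepAux (prog A l) x.regs x.stk).stk k = y.stk k) : Reach A 1 l x l' y := by
  refine ⟨⟨⟨1, ?_⟩, le_rfl⟩⟩
  change some (TM2.stepAux (prog A l) x.regs x.stk) = some ⟨l', y.regs, y.stk⟩
  rw [← hl, ← hv, ← funext hs]

theorem Reach.refl (l : Label) (x : Conf A) : Reach A 0 l x (some l) x :=
  ⟨.refl _ _⟩

theorem Reach.trans {n k : ℕ} {l l' : Label} {l'' : Option Label} {x y z : Conf A}
    (h : Reach A n l x (some l') y) (h' : Reach A k l' y l'' z) : Reach A (n + k) l x l'' z := by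
  obtain ⟨h⟩ := h
  obtain ⟨h'⟩ := h'
  rw [Nat.add_comm]
  exact ⟨h.trans _ _ _ _ _ _ h'⟩

theorem Reach.mono {n k : ℕ} {l : Label} {l' : Option Label} {x y : Conf A}
    (h : Reach A n l x l' y) (hn : n ≤ k) : Reach A k l x l' y := by
  obtain ⟨h⟩ := h
  exact ⟨⟨h.toEvalsTo, h.steps_le_m.trans hn⟩⟩

/-- A loop that moves the elements of a list. -/
theorem Reach.loop {α : Type} {l l' : Label} (F : List α → List α → Conf A)
    (h₁ : ∀ x s t, Reach A 1 l (F (x :: s) t) (some l) (F s (x :: t)))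
    (h₂ : ∀ t, Reach A 1 l (F [] t) (some l') (F [] t)) (s : List α) :
    ∀ t, Reach A (s.length + 1) l (F s t) (some l') (F [] (s.reverse ++ t)) := by
  induction s with
  | nil => exact fun t => (h₂ t).mono (by simp)
  | cons x s ih =>
    intro t
    have h := (h₁ x s t).trans (ih (x :: t))
    rw [Nat.add_comm 1] at h
    simpa using h

/-! ### Loops that copy, rewind or clear a stack. -/

theorem reach_copyIn (x : Conf A) :
    Reach A (x.inp.length + 1) .copyIn x (some .rewA)
      { x with
        inp := [], a' := x.inp.reverse ++ x.a', b' := x.inp.reverse ++ x.b',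
        c' := x.inp.reverse ++ x.c' } := by
  have h := Reach.loop (A := A) (l := .copyIn) (l' := .rewA)
    (fun s (t : List Γ') => { x with inp := s, a' := t ++ x.a', b' := t ++ x.b', c' := t ++ x.c' })
    (fun _ _ _ => .step rfl rfl (by rintro (k | k | k) <;> cases k <;> rfl))
    (fun _ => .step rfl rfl (by rintro (k | k | k) <;> cases k <;> rfl)) x.inp []
  simpa using h

theorem reach_rewA (x : Conf A) :
    Reach A (x.a'.length + 1) .rewA x (some .rewB₀)
      { x with a' := [], a := x.a'.reverse ++ x.a } :=
  Reach.loop (fun s t => { x with a' := s, a := t })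
    (fun _ _ _ => .step rfl rfl (by rintro (k | k | k) <;> cases k <;> rfl))
    (fun _ => .step rfl rfl (by rintro (k | k | k) <;> cases k <;> rfl)) x.a' x.a

theorem reach_rewB₀ (x : Conf A) :
    Reach A (x.b'.length + 1) .rewB₀ x (some .rewC₀)
      { x with b' := [], b := x.b'.reverse ++ x.b } :=
  Reach.loop (fun s t => { x with b' := s, b := t })
    (fun _ _ _ => .step rfl rfl (by rintro (k | k | k) <;> cases k <;> rfl))
    (fun _ => .step rfl rfl (by rintro (k | k | k) <;> cases k <;> rfl)) x.b' x.b

theorem reach_rewC₀ (x : Conf A) :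
    Reach A (x.c'.length + 1) .rewC₀ x (some .getU)
      { x with c' := [], c := x.c'.reverse ++ x.c } :=
  Reach.loop (fun s t => { x with c' := s, c := t })
    (fun _ _ _ => .step rfl rfl (by rintro (k | k | k) <;> cases k <;> rfl))
    (fun _ => .step rfl rfl (by rintro (k | k | k) <;> cases k <;> rfl)) x.c' x.c

theorem reach_restU₀ (x : Conf A) :
    Reach A (x.u'.length + 1) .restU₀ x (some .getW)
      { x with u' := [], u := x.u'.reverse ++ x.u } :=
  Reach.loop (fun s t => { x with u' := s, u := t })
    (fun _ _ _ => .step rfl rfl (by rintro (k | k | k) <;> cases k <;> rfl))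
    (fun _ => .step rfl rfl (by rintro (k | k | k) <;> cases k <;> rfl)) x.u' x.u

theorem reach_restU (x : Conf A) :
    Reach A (x.u'.length + 1) .restU x (some .restW)
      { x with u' := [], u := x.u'.reverse ++ x.u } :=
  Reach.loop (fun s t => { x with u' := s, u := t })
    (fun _ _ _ => .step rfl rfl (by rintro (k | k | k) <;> cases k <;> rfl))
    (fun _ => .step rfl rfl (by rintro (k | k | k) <;> cases k <;> rfl)) x.u' x.u

theorem reach_restW (x : Conf A) :
    Reach A (x.w'.length + 1) .restW x (some .scan)
      { x with w' := [], w := x.w'.reverse ++ x.w } :=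
  Reach.loop (fun s t => { x with w' := s, w := t })
    (fun _ _ _ => .step rfl rfl (by rintro (k | k | k) <;> cases k <;> rfl))
    (fun _ => .step rfl rfl (by rintro (k | k | k) <;> cases k <;> rfl)) x.w' x.w

theorem reach_rewC (x : Conf A) :
    Reach A (x.c'.length + 1) .rewC x (some .clrW)
      { x with c' := [], c := x.c'.reverse ++ x.c } :=
  Reach.loop (fun s t => { x with c' := s, c := t })
    (fun _ _ _ => .step rfl rfl (by rintro (k | k | k) <;> cases k <;> rfl))
    (fun _ => .step rfl rfl (by rintro (k | k | k) <;> cases k <;> rfl)) x.c' x.c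

theorem reach_rewB (x : Conf A) :
    Reach A (x.b'.length + 1) .rewB x (some .clrU)
      { x with b' := [], b := x.b'.reverse ++ x.b } :=
  Reach.loop (fun s t => { x with b' := s, b := t })
    (fun _ _ _ => .step rfl rfl (by rintro (k | k | k) <;> cases k <;> rfl))
    (fun _ => .step rfl rfl (by rintro (k | k | k) <;> cases k <;> rfl)) x.b' x.b

theorem reach_restR (x : Conf A) :
    Reach A (x.r'.length + 1) .restR x (some .zipR)
      { x with r' := [], r := x.r'.reverse ++ x.r } :=
  Reach.loop (fun s t => { x with r' := s, r := t })
    (fun _ _ _ => .step rfl rfl (by rintro (k | k | k) <;> cases k <;> rfl))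
    (fun _ => .step rfl rfl (by rintro (k | k | k) <;> cases k <;> rfl)) x.r' x.r

theorem reach_rewM (x : Conf A) :
    Reach A (x.m'.length + 1) .rewM x (some .clrR)
      { x with m' := [], m := x.m'.reverse ++ x.m } :=
  Reach.loop (fun s t => { x with m' := s, m := t })
    (fun _ _ _ => .step rfl rfl (by rintro (k | k | k) <;> cases k <;> rfl))
    (fun _ => .step rfl rfl (by rintro (k | k | k) <;> cases k <;> rfl)) x.m' x.m

theorem reach_clrW (x : Conf A) :
    Reach A (x.w.length + 1) .clrW x (some .getW) { x with w := [] } :=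
  Reach.loop (fun s _ => { x with w := s })
    (fun _ _ _ => .step rfl rfl (by rintro (k | k | k) <;> cases k <;> rfl))
    (fun _ => .step rfl rfl (by rintro (k | k | k) <;> cases k <;> rfl)) x.w []

theorem reach_clrU (x : Conf A) :
    Reach A (x.u.length + 1) .clrU x (some .getU) { x with u := [] } :=
  Reach.loop (fun s _ => { x with u := s })
    (fun _ _ _ => .step rfl rfl (by rintro (k | k | k) <;> cases k <;> rfl))
    (fun _ => .step rfl rfl (by rintro (k | k | k) <;> cases k <;> rfl)) x.u []

theorem reach_clrR (x : Conf A) :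
    Reach A (x.r'.length + 1) .clrR x (some .elim) { x with r' := [] } :=
  Reach.loop (fun s _ => { x with r' := s })
    (fun _ _ _ => .step rfl rfl (by rintro (k | k | k) <;> cases k <;> rfl))
    (fun _ => .step rfl rfl (by rintro (k | k | k) <;> cases k <;> rfl)) x.r' []

theorem reach_clrB (x : Conf A) :
    Reach A (x.b.length + 1) .clrB x (some .clrC) { x with b := [] } :=
  Reach.loop (fun s _ => { x with b := s })
    (fun _ _ _ => .step rfl rfl (by rintro (k | k | k) <;> cases k <;> rfl))
    (fun _ => .step rfl rfl (by rintro (k | k | k) <;> cases k <;> rfl)) x.b []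

theorem reach_clrC (x : Conf A) :
    Reach A (x.c.length + 1) .clrC x (some .clrM) { x with c := [] } :=
  Reach.loop (fun s _ => { x with c := s })
    (fun _ _ _ => .step rfl rfl (by rintro (k | k | k) <;> cases k <;> rfl))
    (fun _ => .step rfl rfl (by rintro (k | k | k) <;> cases k <;> rfl)) x.c []

theorem reach_clrM (x : Conf A) :
    Reach A (x.m.length + 1) .clrM x (some .fin) { x with m := [] } :=
  Reach.loop (fun s _ => { x with m := s })
    (fun _ _ _ => .step rfl rfl (by rintro (k | k | k) <;> cases k <;> rfl))
    (fun _ => .step rfl rfl (by rintro (k | k | k) <;> cases k <;> rfl)) x.m []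

/-! ### Tokens, and one scan of the text. -/

/-- The tokens of the text of a database. -/
inductive Tok
  | op
  | cl
  | num (l : List Bool)

/-- The text of a token. -/
def Tok.text : Tok → List Γ'
  | .op => [.bra]
  | .cl => [.ket]
  | .num l => l.map .bit ++ [.comma]

/-- The text of a list of tokens. -/
def text (ts : List Tok) : List Γ' := ts.flatMap Tok.text

@[simp]
theorem text_nil : text [] = [] := rfl

@[simp]
theorem text_cons (t : Tok) (ts : List Tok) : text (t :: ts) = t.text ++ text ts := rfl

/-- The constants in a list of tokens. -/
def nums : List Tok → List (List Bool)
  | [] => []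
  | .num l :: ts => l :: nums ts
  | .op :: ts => nums ts
  | .cl :: ts => nums ts

theorem length_le_length_text (ts : List Tok) : ts.length ≤ (text ts).length := by
  induction ts with
  | nil => simp
  | cons t ts ih => cases t <;> simp [Tok.text] <;> omega

theorem length_le_of_mem_nums {ts : List Tok} {l : List Bool} (h : l ∈ nums ts) :
    l.length ≤ (text ts).length := by
  induction ts with
  | nil => simp [nums] at h
  | cons t ts ih =>
    cases t with
    | num k =>
      rcases List.mem_cons.1 h with rfl | h
      · simp [Tok.text]
      · have := ih h
        simp; omega
    | _ =>
      have := ih h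
      simp; omega

theorem length_nums_le (ts : List Tok) : (nums ts).length ≤ ts.length := by
  induction ts with
  | nil => simp [nums]
  | cons t ts ih => cases t <;> simp [nums] <;> omega

/-- How the automaton reads a token, if it compares the constants to `u` and `w`. -/
def Scanner.tok (A : Scanner S) (u w : List Bool) (d : S) : Tok → S
  | .op => A.sym d .bra
  | .cl => A.sym d .ket
  | .num l => A.num (l.foldl (fun d b => A.sym d (.bit b)) d) (l = u) (l = w)

/-- The constraint for the constants `u` and `w`. -/
def Scanner.entry (A : Scanner S) (ts : List Tok) (u w : List Bool) : BoolRel :=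
  A.out (ts.foldl (A.tok u w) A.start)

theorem reach_scan_bit (x : Conf A) (b : Bool) (s C U U' W W' : List Γ') (p q : Bool) (d : S) :
    Reach A 1 .scan
      { x with
        c := .bit b :: s, c' := C, u := U, u' := U', w := W, w' := W', p := p, q := q, d := d }
      (some .scan)
      { x with
        c := s, c' := .bit b :: C, u := U.tail, u' := U.head?.toList ++ U',
        w := W.tail, w' := W.head?.toList ++ W',
        p := p && U.head? == some (.bit b), q := q && W.head? == some (.bit b),
        d := A.sym d (.bit b) } := by
  cases U <;> cases W <;>
    exact .step rfl rfl (by rintro (k | k | k) <;> cases k <;> rfl)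

/-- One step of the bitwise comparison: the flag absorbs the comparison of the heads and leaves the
tails to be compared. -/
theorem and_head_and_tail (p : Bool) (b : Bool) (l : List Bool) (U : List Γ') :
    ((p && U.head? == some (.bit b)) && decide (l.map Γ'.bit = U.tail)) =
      (p && decide ((b :: l).map Γ'.bit = U)) := by
  cases U with
  | nil => simp
  | cons y U =>
    have h : (some y == some (Γ'.bit b)) = decide (Γ'.bit b = y) := by
      rw [Bool.eq_iff_iff, beq_iff_eq, decide_eq_true_iff, Option.some_inj, eq_comm]
    simp only [List.head?_cons, List.tail_cons, List.map_cons, List.cons.injEq, h, Bool.and_assoc,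
      Bool.decide_and]
    congr

/-- The flags record agreement on the bits read so far, while `U` and `W` hold what is left of the
reference constants. Since `U'.reverse ++ U` and `W'.reverse ++ W` are invariant, the references are
intact after the final rewinding, and their lengths bound its cost. -/
theorem reach_scan_num (x : Conf A) (l : List Bool) (s : List Γ') :
    ∀ (C U U' W W' : List Γ') (p q : Bool) (d : S),
    Reach A (l.length + 3 + (U.length + U'.length + (W.length + W'.length))) .scan
      { x with
        c := (Tok.num l).text ++ s, c' := C, u := U, u' := U', w := W, w' := W',
        p := p, q := q, d := d }
      (some .scan)
      { x with
        c := s, c' := (Tok.num l).text.reverse ++ C, u := U'.reverse ++ U, u' := [],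
        w := W'.reverse ++ W, w' := [], p := true, q := true,
        d := A.num (l.foldl (fun d b => A.sym d (.bit b)) d)
          (p && decide (l.map Γ'.bit = U)) (q && decide (l.map Γ'.bit = W)) } := by
  induction l with
  | nil =>
    intro C U U' W W' p q d
    have h₁ : Reach A 1 .scan
        { x with
          c := .comma :: s, c' := C, u := U, u' := U', w := W, w' := W', p := p, q := q, d := d }
        (some .restU)
        { x with
          c := s, c' := .comma :: C, u := U, u' := U', w := W, w' := W', p := true, q := true,
          d := A.num d (p && decide ([] = U)) (q && decide ([] = W)) } := by
      cases U <;> cases W <;>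
        exact .step rfl rfl (by rintro (k | k | k) <;> cases k <;> rfl)
    refine ((h₁.trans (reach_restU _)).trans (reach_restW _)).mono ?_
    simp only [List.length_nil]
    omega
  | cons b l ih =>
    intro C U U' W W' p q d
    have h := (reach_scan_bit x b ((Tok.num l).text ++ s) C U U' W W' p q d).trans
      (ih _ _ _ _ _ _ _ _)
    rw [and_head_and_tail, and_head_and_tail] at h
    have hU : U'.reverse ++ U = (U.head?.toList ++ U').reverse ++ U.tail := by cases U <;> simp
    have hW : W'.reverse ++ W = (W.head?.toList ++ W').reverse ++ W.tail := by cases W <;> simp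
    have hC : (Tok.num (b :: l)).text.reverse ++ C = (Tok.num l).text.reverse ++ .bit b :: C := by
      simp [Tok.text]
    rw [hU, hW, hC]
    refine h.mono ?_
    cases U <;> cases W <;> simp <;> omega

theorem map_bit_inj {l u : List Bool} : l.map Γ'.bit = u.map Γ'.bit ↔ l = u :=
  (List.map_injective_iff.2 fun _ _ h => Γ'.bit.inj h).eq_iff

/-- Charging `2 * n + 3` steps to every symbol pays for restoring both references at each comma. -/
theorem reach_scan (x : Conf A) (u w : List Bool) (n : ℕ) (hu : u.length ≤ n) (hw : w.length ≤ n)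
    (ts : List Tok) : ∀ (C : List Γ') (d : S),
    Reach A ((text ts).length * (2 * n + 3)) .scan
      { x with
        c := text ts, c' := C, u := u.map .bit, u' := [], w := w.map .bit, w' := [],
        p := true, q := true, d := d }
      (some .scan)
      { x with
        c := [], c' := (text ts).reverse ++ C, u := u.map .bit, u' := [], w := w.map .bit, w' := [],
        p := true, q := true, d := ts.foldl (A.tok u w) d } := by
  induction ts with
  | nil => exact fun C d => (Reach.refl _ _).mono (Nat.zero_le _)
  | cons t ts ih =>
    intro C d
    have key : Reach A (t.text.length * (2 * n + 3)) .scan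
        { x with
          c := t.text ++ text ts, c' := C, u := u.map .bit, u' := [], w := w.map .bit, w' := [],
          p := true, q := true, d := d }
        (some .scan)
        { x with
          c := text ts, c' := t.text.reverse ++ C, u := u.map .bit, u' := [], w := w.map .bit,
          w' := [], p := true, q := true, d := A.tok u w d t } := by
      cases t with
      | num l =>
        have h := reach_scan_num x l (text ts) C (u.map .bit) [] (w.map .bit) [] true true d
        simp only [map_bit_inj, Bool.true_and, List.reverse_nil, List.nil_append] at h
        refine h.mono ?_
        simp [Tok.text]
        nlinarith
      | _ =>
        refine Reach.mono (.step rfl rfl (by rintro (k | k | k) <;> cases k <;> rfl)) ?_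
        simp [Tok.text]
    have h := key.trans (ih _ _)
    rw [← Nat.add_mul, ← List.length_append, ← List.append_assoc, ← List.reverse_append] at h
    exact h

/-! ### Filling the matrix of constraints. -/

theorem reach_getW_num (x : Conf A) (l : List Bool) (s : List Γ') : ∀ B W : List Γ',
    Reach A (l.length + 1) .getW
      { x with b := (Tok.num l).text ++ s, b' := B, w' := W }
      (some .restU)
      { x with b := s, b' := (Tok.num l).text.reverse ++ B, w' := (l.map .bit).reverse ++ W } := by
  induction l with
  | nil => exact fun B W => .step rfl rfl (by rintro (k | k | k) <;> cases k <;> rfl)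
  | cons b l ih =>
    intro B W
    have h₁ : Reach A 1 .getW
        { x with b := (Tok.num (b :: l)).text ++ s, b' := B, w' := W } (some .getW)
        { x with b := (Tok.num l).text ++ s, b' := .bit b :: B, w' := .bit b :: W } :=
      .step rfl rfl (by rintro (k | k | k) <;> cases k <;> rfl)
    have hC : (Tok.num (b :: l)).text.reverse ++ B = (Tok.num l).text.reverse ++ .bit b :: B := by
      simp [Tok.text]
    have hW : ((b :: l).map Γ'.bit).reverse ++ W = (l.map Γ'.bit).reverse ++ .bit b :: W := by simp
    rw [hC, hW]
    refine (h₁.trans (ih _ _)).mono ?_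
    simp only [List.length_cons]
    omega

/-- Computing one entry of the matrix. -/
theorem reach_entry (x : Conf A) (ts : List Tok) (u l : List Bool) (s B : List Γ')
    (M : List (Option BoolRel)) (n : ℕ) (hn : (text ts).length ≤ n) (hu : u.length ≤ n)
    (hl : l.length ≤ n) :
    Reach A (n * (2 * n + 3) + 4 * n + 6) .getW
      { x with
        b := (Tok.num l).text ++ s, b' := B, c := text ts, c' := [], u := u.map .bit, u' := [],
        w := [], w' := [], m := M, p := true, q := true, d := A.start }
      (some .getW)
      { x with
        b := s, b' := (Tok.num l).text.reverse ++ B, c := text ts, c' := [], u := u.map .bit,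
        u' := [], w := [], w' := [], m := some (A.entry ts u l) :: M,
        p := true, q := true, d := A.start } := by
  let x₁ : Conf A := { x with
    b := s, b' := (Tok.num l).text.reverse ++ B, c := text ts, c' := [], u := u.map .bit,
    u' := [], w := l.map .bit, w' := [], m := M, p := true, q := true, d := A.start }
  let x₂ : Conf A := { x₁ with w := [], w' := (l.map .bit).reverse }
  let x₃ : Conf A := { x₁ with
    c := [], c' := (text ts).reverse, d := ts.foldl (A.tok u l) A.start }
  let x₄ : Conf A := { x₁ with
    c := [], c' := (text ts).reverse, m := some (A.entry ts u l) :: M }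
  have h₁ : Reach A (l.length + 1) .getW
      { x with
        b := (Tok.num l).text ++ s, b' := B, c := text ts, c' := [], u := u.map .bit, u' := [],
        w := [], w' := [], m := M, p := true, q := true, d := A.start } (some .restU) x₂ := by
    have h := reach_getW_num (A := A) { x₂ with w' := [] } l s B []
    rw [List.append_nil] at h
    exact h
  have h₂ : Reach A 1 .restU x₂ (some .restW) x₂ := reach_restU x₂
  have h₃ : Reach A (l.length + 1) .restW x₂ (some .scan) x₁ := by
    have h := reach_restW x₂
    simp only [x₂, List.reverse_reverse, List.append_nil, List.length_reverse, List.length_map] at h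
    exact h
  have h₄ : Reach A ((text ts).length * (2 * n + 3)) .scan x₁ (some .scan) x₃ := by
    have h := reach_scan x₁ u l n hu hl ts [] A.start
    rw [List.append_nil] at h
    exact h
  have h₅ : Reach A 1 .scan x₃ (some .rewC) x₄ :=
    .step rfl rfl (by rintro (k | k | k) <;> cases k <;> rfl)
  have h₆ : Reach A ((text ts).length + 1) .rewC x₄ (some .clrW)
      { x₁ with m := some (A.entry ts u l) :: M } := by
    have h := reach_rewC x₄
    simp only [x₄, List.reverse_reverse, List.append_nil, List.length_reverse] at h
    exact h
  have h₇ : Reach A (l.length + 1) .clrW { x₁ with m := some (A.entry ts u l) :: M } (some .getW)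
      { x₁ with m := some (A.entry ts u l) :: M, w := [] } := by
    have h := reach_clrW (A := A) { x₁ with m := some (A.entry ts u l) :: M }
    simp only [x₁, List.length_map] at h
    exact h
  refine ((((((h₁.trans h₂).trans h₃).trans h₄).trans h₅).trans h₆).trans h₇).mono ?_
  have := Nat.mul_le_mul_right (2 * n + 3) hn
  omega

/-- Computing the entries of a row of the matrix. -/
theorem reach_entries (x : Conf A) (ts : List Tok) (u : List Bool) (n : ℕ)
    (hn : (text ts).length ≤ n) (hu : u.length ≤ n) (ts' : List Tok)
    (h : ∀ l ∈ nums ts', l.length ≤ n) : ∀ (B : List Γ') (M : List (Option BoolRel)),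
    Reach A (ts'.length * (n * (2 * n + 3) + 4 * n + 6)) .getW
      { x with
        b := text ts', b' := B, c := text ts, c' := [], u := u.map .bit, u' := [],
        w := [], w' := [], m := M, p := true, q := true, d := A.start }
      (some .getW)
      { x with
        b := [], b' := (text ts').reverse ++ B, c := text ts, c' := [], u := u.map .bit,
        u' := [], w := [], w' := [],
        m := ((nums ts').map fun l => some (A.entry ts u l)).reverse ++ M,
        p := true, q := true, d := A.start } := by
  induction ts' with
  | nil => exact fun B M => (Reach.refl _ _).mono (Nat.zero_le _)
  | cons t ts' ih =>
    intro B M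
    rw [List.length_cons, Nat.add_mul, Nat.add_comm, Nat.one_mul, text_cons, List.reverse_append,
      List.append_assoc]
    cases t with
    | num l =>
      have hl := reach_entry x ts u l (text ts') B M n hn hu (h l List.mem_cons_self)
      have hM : ((nums (.num l :: ts')).map fun l => some (A.entry ts u l)).reverse ++ M =
          ((nums ts').map fun l => some (A.entry ts u l)).reverse ++ some (A.entry ts u l) :: M := by
        simp [nums]
      rw [hM]
      exact hl.trans (ih (fun l hl => h l (List.mem_cons_of_mem _ hl)) _ _)
    | _ =>
      refine Reach.trans (Reach.mono (.step rfl rfl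
        (by rintro (k | k | k) <;> cases k <;> rfl)) ?_) (ih h _ _)
      omega

theorem reach_getU_num (x : Conf A) (l : List Bool) (s : List Γ') : ∀ U : List Γ',
    Reach A (l.length + 1) .getU { x with a := (Tok.num l).text ++ s, u' := U }
      (some .restU₀) { x with a := s, u' := (l.map .bit).reverse ++ U, m := none :: x.m } := by
  induction l with
  | nil => exact fun U => .step rfl rfl (by rintro (k | k | k) <;> cases k <;> rfl)
  | cons b l ih =>
    intro U
    have h₁ : Reach A 1 .getU { x with a := (Tok.num (b :: l)).text ++ s, u' := U } (some .getU)
        { x with a := (Tok.num l).text ++ s, u' := .bit b :: U } :=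
      .step rfl rfl (by rintro (k | k | k) <;> cases k <;> rfl)
    have hW : ((b :: l).map Γ'.bit).reverse ++ U = (l.map Γ'.bit).reverse ++ .bit b :: U := by simp
    rw [hW]
    refine (h₁.trans (ih _)).mono ?_
    simp only [List.length_cons]
    omega

/-- A bound for the time needed to compute a row of the matrix. -/
def rowTime (n : ℕ) : ℕ := n * (n * (2 * n + 3) + 4 * n + 6) + 4 * n + 6

/-- Computing one row of the matrix. -/
theorem reach_row (ts : List Tok) (l : List Bool) (s : List Γ')
    (M : List (Option BoolRel)) (n : ℕ) (hn : (text ts).length ≤ n) (hl : l.length ≤ n) :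
    Reach A (rowTime n) .getU
      { a := (Tok.num l).text ++ s, b := text ts, c := text ts, m := M }
      (some .getU)
      { a := s, b := text ts, c := text ts,
        m := ((nums ts).map fun w => some (A.entry ts l w)).reverse ++ none :: M } := by
  let M' := ((nums ts).map fun w => some (A.entry ts l w)).reverse ++ none :: M
  have h₁ : Reach A (l.length + 1) .getU
      { a := (Tok.num l).text ++ s, b := text ts, c := text ts, m := M } (some .restU₀)
      { a := s, b := text ts, c := text ts, u' := (l.map .bit).reverse, m := none :: M } := by
    have h := reach_getU_num (A := A) { b := text ts, c := text ts, m := M } l s []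
    rw [List.append_nil] at h
    exact h
  have h₂ : Reach A (l.length + 1) .restU₀
      { a := s, b := text ts, c := text ts, u' := (l.map .bit).reverse, m := none :: M } (some .getW)
      { a := s, b := text ts, c := text ts, u := l.map .bit, m := none :: M } := by
    have h := reach_restU₀ (A := A)
      { a := s, b := text ts, c := text ts, u' := (l.map .bit).reverse, m := none :: M }
    simp only [List.reverse_reverse, List.append_nil, List.length_reverse, List.length_map] at h
    exact h
  have h₃ := reach_entries (A := A) { a := s } ts l n hn hl ts
    (fun w hw => (length_le_of_mem_nums hw).trans hn) [] (none :: M)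
  rw [List.append_nil] at h₃
  have h₄ : Reach A 1 .getW
      { a := s, b := [], b' := (text ts).reverse, c := text ts, u := l.map .bit, m := M' }
      (some .rewB)
      { a := s, b := [], b' := (text ts).reverse, c := text ts, u := l.map .bit, m := M' } :=
    .step rfl rfl (by rintro (k | k | k) <;> cases k <;> rfl)
  have h₅ : Reach A ((text ts).length + 1) .rewB
      { a := s, b := [], b' := (text ts).reverse, c := text ts, u := l.map .bit, m := M' }
      (some .clrU) { a := s, b := text ts, c := text ts, u := l.map .bit, m := M' } := by
    have h := reach_rewB (A := A)
      { a := s, b := [], b' := (text ts).reverse, c := text ts, u := l.map .bit, m := M' }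
    simp only [List.reverse_reverse, List.append_nil, List.length_reverse] at h
    exact h
  have h₆ : Reach A (l.length + 1) .clrU
      { a := s, b := text ts, c := text ts, u := l.map .bit, m := M' } (some .getU)
      { a := s, b := text ts, c := text ts, m := M' } := by
    have h := reach_clrU (A := A) { a := s, b := text ts, c := text ts, u := l.map .bit, m := M' }
    simp only [List.length_map] at h
    exact h
  refine (((((h₁.trans h₂).trans h₃).trans h₄).trans h₅).trans h₆).mono ?_
  have := Nat.mul_le_mul_right (n * (2 * n + 3) + 4 * n + 6) ((length_le_length_text ts).trans hn)
  unfold rowTime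
  omega

/-- Computing the rows of the matrix. -/
theorem reach_rows (ts : List Tok) (n : ℕ) (hn : (text ts).length ≤ n) (ts' : List Tok)
    (h : ∀ l ∈ nums ts', l.length ≤ n) : ∀ M : List (Option BoolRel),
    Reach A (ts'.length * rowTime n + 1) .getU
      { a := text ts', b := text ts, c := text ts, m := M }
      (some .elim)
      { b := text ts, c := text ts,
        m := (nums ts').reverse.flatMap (fun u =>
          (nums ts).reverse.map (fun w => some (A.entry ts u w)) ++ [none]) ++ M } := by
  induction ts' with
  | nil =>
    exact fun M => Reach.mono (.step rfl rfl (by rintro (k | k | k) <;> cases k <;> rfl)) (by omega)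
  | cons t ts' ih =>
    intro M
    rw [List.length_cons, Nat.add_mul, Nat.one_mul, Nat.add_comm _ (rowTime n), Nat.add_assoc]
    cases t with
    | num l =>
      have hl := reach_row (A := A) ts l (text ts') M n hn (h l List.mem_cons_self)
      have h' := hl.trans (ih (fun l hl => h l (List.mem_cons_of_mem _ hl)) _)
      simpa [nums, List.flatMap_append] using h'
    | _ =>
      refine Reach.trans (Reach.mono (.step rfl rfl
        (by rintro (k | k | k) <;> cases k <;> rfl)) ?_) (ih h _)
      unfold rowTime
      omega

/-- Computing the matrix. -/
theorem reach_matrix (ts : List Tok) (n : ℕ) (hn : (text ts).length ≤ n) :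
    Reach A (n * rowTime n + 4 * n + 5) .copyIn { inp := text ts } (some .elim)
      { b := text ts, c := text ts,
        m := (nums ts).reverse.flatMap (fun u =>
          (nums ts).reverse.map (fun w => some (A.entry ts u w)) ++ [none]) } := by
  have h₁ := reach_copyIn (A := A) { inp := text ts }
  have h₂ := h₁.trans (reach_rewA _)
  have h₃ := h₂.trans (reach_rewB₀ _)
  have h₄ := h₃.trans (reach_rewC₀ _)
  simp only [List.reverse_reverse, List.append_nil, List.length_reverse] at h₄
  have h₅ := h₄.trans (reach_rows ts n hn ts
    (fun w hw => (length_le_of_mem_nums hw).trans hn) [])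
  rw [List.append_nil] at h₅
  refine h₅.mono ?_
  have := Nat.mul_le_mul_right (rowTime n) ((length_le_length_text ts).trans hn)
  omega

end Runs
-- Boolean systems of binary constraints.
/-- Decide a system of binary Boolean constraints by eliminating the variables one by one. -/
def solve : ℕ → (ℕ → ℕ → BoolRel) → Bool
  | 0, _ => true
  | k + 1, M => (M 0 0 true true || M 0 0 false false) && solve k fun i j =>
      eliminate (M 0 0) (M (i + 1) 0) (M (i + 1) (j + 1)) (M 0 (j + 1))

/-- Suppose that a solution of the eliminated system does not extend to the first variable. Then
each of its two values is excluded by its own constraint or by some other variable, and the at most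
two variables responsible violate an eliminated constraint. The explicit test of `M 0 0` is needed
when no other variable is left to carry it. -/
theorem solve_iff (k : ℕ) : ∀ (M : ℕ → ℕ → BoolRel),
    (∀ i < k, ∀ j < k, ∀ p q, M i j p q = M j i q p) →
    (solve k M = true ↔ ∃ v : ℕ → Bool, ∀ i < k, ∀ j < k, M i j (v i) (v j) = true) := by
  induction k with
  | zero => simp [solve]
  | succ k ih =>
    intro M hM
    have hM₀ (i) (hi : i < k) (p q) : M 0 (i + 1) p q = M (i + 1) 0 q p :=
      hM 0 (by omega) (i + 1) (by omega) p q
    rw [solve, Bool.and_eq_true, ih _ fun i hi j hj p q => by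
      simp only [eliminate, hM (j + 1) (by omega) (i + 1) (by omega) q p, hM₀ i hi, hM₀ j hj]
      grind]
    constructor
    · rintro ⟨h₀, v, hv⟩
      simp only [eliminate, Bool.and_eq_true, Bool.or_eq_true] at hv h₀
      -- The Helly-type step: pairwise compatibility through the first variable yields one value
      -- that suits all the others.
      obtain ⟨p, hp, hp'⟩ : ∃ p, M 0 0 p p = true ∧ ∀ i < k, M (i + 1) 0 (v i) p = true := by
        by_contra! hne
        have h (p) (hp : M 0 0 p p = true) := hne p hp
        have ht : ∃ p, M 0 0 p p = true := h₀.elim (fun h => ⟨_, h⟩) (fun h => ⟨_, h⟩)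
        obtain ⟨p, hp⟩ := ht
        obtain ⟨i, hi, hi'⟩ := h p hp
        by_cases hq : M 0 0 (!p) (!p) = true
        · obtain ⟨j, hj, hj'⟩ := h _ hq
          have h₁ := (hv i hi j hj).2
          simp only [hM₀ j hj] at h₁
          clear hM hM₀ ih
          cases p <;> simp_all
        -- Only `p` is allowed by `M 0 0`, so the eliminated constraint of the refuting variable
        -- with itself already fails.
        · have h₁ := (hv i hi i hi).2
          clear hM hM₀ ih
          cases p <;> simp_all
      refine ⟨fun i => i.casesOn p v, ?_⟩
      rintro (_ | i) hi (_ | j) hj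
      · exact hp
      · rw [hM₀ j (by omega)]; exact hp' j (by omega)
      · exact hp' i (by omega)
      · exact (hv i (by omega) j (by omega)).1
    · rintro ⟨v, hv⟩
      have h₀ := hv 0 (by omega) 0 (by omega)
      clear hM hM₀ ih
      refine ⟨?_, fun i => v (i + 1), fun i hi j hj => ?_⟩
      · clear hv
        cases hp : v 0 <;> simp_all
      · have h₁ := hv (i + 1) (by omega) 0 (by omega)
        have h₂ := hv 0 (by omega) (j + 1) (by omega)
        have h₃ := hv (i + 1) (by omega) (j + 1) (by omega)
        clear hv
        simp only [eliminate]
        cases hp : v 0 <;> simp_all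

/-- The matrix as it is written on a stack. -/
def matrixText (is js : List ℕ) (M : ℕ → ℕ → BoolRel) : List (Option BoolRel) :=
  is.flatMap fun i => js.map (fun j => some (M i j)) ++ [none]

theorem length_matrixText (is js : List ℕ) (M : ℕ → ℕ → BoolRel) :
    (matrixText is js M).length = is.length * (js.length + 1) := by
  simp [matrixText, List.length_flatMap]

/-! ### Elimination on the machine, and its total running time. -/

section Runs

variable {S : Type} {A : Scanner S}

theorem reach_loadR (x : Conf A) (s : List (Option BoolRel)) (f : ℕ → BoolRel) (js : List ℕ) :
    ∀ R : List (Option BoolRel), Reach A (js.length + 1) .loadR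
      { x with m := js.map (fun j => some (f j)) ++ none :: s, r' := R } (some .rowHead)
      { x with m := s, r' := (js.map fun j => some (f j)).reverse ++ R } := by
  induction js with
  | nil => exact fun R => .step rfl rfl (by rintro (k | k | k) <;> cases k <;> rfl)
  | cons j js ih =>
    intro R
    have h₁ : Reach A 1 .loadR
        { x with m := (j :: js).map (fun j => some (f j)) ++ none :: s, r' := R } (some .loadR)
        { x with m := js.map (fun j => some (f j)) ++ none :: s, r' := some (f j) :: R } :=
      .step rfl rfl (by rintro (k | k | k) <;> cases k <;> rfl)
    have h := h₁.trans (ih _)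
    rw [Nat.add_comm 1] at h
    simpa using h

/-- The row of the eliminated variable is consumed from `r` and saved on `r'`, ready for the next
row of the matrix. -/
theorem reach_zipR (x : Conf A) (s : List (Option BoolRel)) (f g : ℕ → BoolRel) (js : List ℕ) :
    ∀ R N : List (Option BoolRel), Reach A (js.length + 1) .zipR
      { x with
        m := js.map (fun j => some (f j)) ++ none :: s, m' := N,
        r := js.map fun j => some (g j), r' := R }
      (some .rowHead)
      { x with
        m := s,
        m' := (js.map (fun j => some (eliminate x.m₀ x.l₀ (f j) (g j))) ++ [none]).reverse ++ N,
        r := [], r' := (js.map fun j => some (g j)).reverse ++ R, l₀ := fun _ _ => false } := by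
  induction js with
  | nil => exact fun R N => .step rfl rfl (by rintro (k | k | k) <;> cases k <;> rfl)
  | cons j js ih =>
    intro R N
    have h₁ : Reach A 1 .zipR
        { x with
          m := (j :: js).map (fun j => some (f j)) ++ none :: s, m' := N,
          r := (j :: js).map fun j => some (g j), r' := R } (some .zipR)
        { x with
          m := js.map (fun j => some (f j)) ++ none :: s,
          m' := some (eliminate x.m₀ x.l₀ (f j) (g j)) :: N,
          r := js.map fun j => some (g j), r' := some (g j) :: R } :=
      .step rfl rfl (by rintro (k | k | k) <;> cases k <;> rfl)
    have h := h₁.trans (ih _ _)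
    rw [Nat.add_comm 1] at h
    simpa using h

/-- Eliminating a variable from all rows. -/
theorem reach_rowHead (x : Conf A) (m₀ : BoolRel) (h g : ℕ → BoolRel) (f : ℕ → ℕ → BoolRel)
    (js is : List ℕ) : ∀ N : List (Option BoolRel),
    Reach A (is.length * (2 * js.length + 3)) .rowHead
      { x with
        m := is.flatMap fun i => some (h i) :: (js.map (fun j => some (f i j)) ++ [none]), m' := N,
        r := [], r' := (js.map fun j => some (g j)).reverse, m₀ := m₀, l₀ := fun _ _ => false }
      (some .rowHead)
      { x with
        m := [], m' := (matrixText is js fun i j => eliminate m₀ (h i) (f i j) (g j)).reverse ++ N,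
        r := [], r' := (js.map fun j => some (g j)).reverse,
        m₀ := m₀, l₀ := fun _ _ => false } := by
  induction is with
  | nil => exact fun N => (Reach.refl _ _).mono (Nat.zero_le _)
  | cons i is ih =>
    intro N
    let s := is.flatMap fun i => some (h i) :: (js.map (fun j => some (f i j)) ++ [none])
    let x₁ : Conf A := { x with
      m := js.map (fun j => some (f i j)) ++ none :: s, m' := N,
      r := [], r' := (js.map fun j => some (g j)).reverse, m₀ := m₀, l₀ := h i }
    have h₁ : Reach A 1 .rowHead { x₁ with m := some (h i) :: x₁.m, l₀ := fun _ _ => false }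
        (some .restR) x₁ :=
      .step rfl rfl (by rintro (k | k | k) <;> cases k <;> rfl)
    have h₂ := reach_restR x₁
    simp only [x₁, List.reverse_reverse, List.append_nil, List.length_reverse, List.length_map] at h₂
    have h₃ := reach_zipR (A := A) { x₁ with r' := [] } s (f i) g js [] N
    simp only [x₁, List.append_nil] at h₃
    have h₄ := ((h₁.trans h₂).trans h₃).trans (ih _)
    have hm : (List.flatMap (fun i => some (h i) :: (js.map (fun j => some (f i j)) ++ [none]))
        (i :: is)) = some (h i) :: x₁.m := by
      simp [x₁, s]
    have hm' : (matrixText (i :: is) js fun i j => eliminate m₀ (h i) (f i j) (g j)).reverse ++ N =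
        (matrixText is js fun i j => eliminate m₀ (h i) (f i j) (g j)).reverse ++
          ((js.map (fun j => some (eliminate m₀ (h i) (f i j) (g j))) ++ [none]).reverse ++ N) := by
      simp [matrixText]
    rw [hm, hm']
    refine h₄.mono ?_
    rw [List.length_cons, Nat.add_mul]
    omega

/-- Eliminating a variable. -/
theorem reach_elim_step (k : ℕ) (B C : List Γ') (M : ℕ → ℕ → BoolRel)
    (h₀ : (M 0 0 true true || M 0 0 false false) = true) :
    Reach A (k * (3 * k + 4) + 2 * k + 5) .elim
      { b := B, c := C, m := matrixText (List.range (k + 1)) (List.range (k + 1)) M }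
      (some .elim)
      { b := B, c := C, m := matrixText (List.range k) (List.range k) fun i j =>
        eliminate (M 0 0) (M (i + 1) 0) (M (i + 1) (j + 1)) (M 0 (j + 1)) } := by
  let js := List.range k
  let s := js.flatMap fun i =>
    some (M (i + 1) 0) :: (js.map (fun j => some (M (i + 1) (j + 1))) ++ [none])
  let N := matrixText js js fun i j =>
    eliminate (M 0 0) (M (i + 1) 0) (M (i + 1) (j + 1)) (M 0 (j + 1))
  let R := (js.map fun j => some (M 0 (j + 1))).reverse
  have hm : matrixText (List.range (k + 1)) (List.range (k + 1)) M =
      some (M 0 0) :: (js.map (fun j => some (M 0 (j + 1))) ++ none :: s) := by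
    simp [matrixText, List.range_succ_eq_map, s, js, List.flatMap_map, Function.comp_def]
  have h₁ : Reach A 1 .elim
      { b := B, c := C, m := matrixText (List.range (k + 1)) (List.range (k + 1)) M } (some .loadR)
      { b := B, c := C, m := js.map (fun j => some (M 0 (j + 1))) ++ none :: s, m₀ := M 0 0 } := by
    rw [hm]
    let y : Conf A :=
      { b := B, c := C, m := some (M 0 0) :: (js.map (fun j => some (M 0 (j + 1))) ++ none :: s) }
    -- The branch depends on the unknown `M`, so evaluation gets stuck there; the test is exposed
    -- and decided by `h₀`.
    have hj : TM2.stepAux (prog A .elim) y.regs y.stk =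
        bif (M 0 0 true true || M 0 0 false false) then _ else _ := rfl
    rw [h₀, cond_true] at hj
    exact .step (by rw [hj]; rfl) (by rw [hj]; rfl)
      (by rw [hj]; rintro (k | k | k) <;> cases k <;> rfl)
  have h₂ := reach_loadR (A := A) { b := B, c := C, m₀ := M 0 0 } s (fun j => M 0 (j + 1)) js []
  rw [List.append_nil] at h₂
  have h₃ := reach_rowHead (A := A) { b := B, c := C } (M 0 0) (fun i => M (i + 1) 0)
    (fun j => M 0 (j + 1)) (fun i j => M (i + 1) (j + 1)) js js []
  rw [List.append_nil] at h₃
  have h₄ : Reach A 1 .rowHead { b := B, c := C, m' := N.reverse, r' := R, m₀ := M 0 0 }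
      (some .rewM) { b := B, c := C, m' := N.reverse, r' := R } :=
    .step rfl rfl (by rintro (k | k | k) <;> cases k <;> rfl)
  have h₅ := reach_rewM (A := A) { b := B, c := C, m' := N.reverse, r' := R }
  have h₆ := (h₅.trans (reach_clrR _))
  simp only [R, N, List.reverse_reverse, List.append_nil, List.length_reverse, List.length_map,
    length_matrixText] at h₆
  refine ((((h₁.trans h₂).trans h₃).trans h₄).trans h₆).mono ?_
  simp only [js, List.length_range]
  have : k * (3 * k + 4) = k * (2 * k + 3) + k * (k + 1) := by ring
  omega

/-- Solving the system of constraints. -/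
theorem reach_elim (B C : List Γ') (k : ℕ) : ∀ M : ℕ → ℕ → BoolRel,
    ∃ m : List (Option BoolRel), m.length ≤ k * (k + 1) ∧
      Reach A (k * (k * (3 * k + 4) + 2 * k + 5) + 1) .elim
        { b := B, c := C, m := matrixText (List.range k) (List.range k) M }
        (some .clrB) { b := B, c := C, m := m, ans := solve k M } := by
  induction k with
  | zero =>
    exact fun M => ⟨[], by simp, Reach.mono
      (.step rfl rfl (by rintro (k | k | k) <;> cases k <;> rfl)) (by omega)⟩
  | succ k ih =>
    intro M
    rcases h₀ : (M 0 0 true true || M 0 0 false false) with _ | _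
    -- A failed test stops the elimination with the rest of the matrix still on the stack; this is
    -- why the leftover `m` is existential and only its length is bounded.
    · refine ⟨(matrixText (List.range (k + 1)) (List.range (k + 1)) M).tail, ?_, ?_⟩
      · rw [List.length_tail, length_matrixText]
        simp
      · rw [solve, h₀, Bool.false_and]
        obtain ⟨s, hs⟩ : ∃ s, matrixText (List.range (k + 1)) (List.range (k + 1)) M =
            some (M 0 0) :: s := by
          simp [matrixText, List.range_succ_eq_map]
        rw [hs]
        let y : Conf A := { b := B, c := C, m := some (M 0 0) :: s }
        have hj : TM2.stepAux (prog A .elim) y.regs y.stk =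
            bif (M 0 0 true true || M 0 0 false false) then _ else _ := rfl
        rw [h₀, cond_false] at hj
        exact Reach.mono (.step (by rw [hj]; rfl) (by rw [hj]; rfl)
          (by rw [hj]; rintro (k | k | k) <;> cases k <;> rfl)) (by omega)
    · obtain ⟨m, hm, h⟩ := ih fun i j =>
        eliminate (M 0 0) (M (i + 1) 0) (M (i + 1) (j + 1)) (M 0 (j + 1))
      refine ⟨m, hm.trans (by gcongr <;> omega), ?_⟩
      rw [solve, h₀, Bool.true_and]
      refine ((reach_elim_step k B C M h₀).trans h).mono ?_
      have : k * (k * (3 * k + 4) + 2 * k + 5) ≤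
          k * ((k + 1) * (3 * (k + 1) + 4) + 2 * (k + 1) + 5) := by gcongr <;> omega
      have : k * (3 * k + 4) ≤ (k + 1) * (3 * (k + 1) + 4) := by gcongr <;> omega
      rw [Nat.add_mul k 1]
      omega

theorem reach_fin (B C : List Γ') (m : List (Option BoolRel)) (v : Bool) :
    Reach A (B.length + C.length + m.length + 4) .clrB { b := B, c := C, m := m, ans := v }
      none { out := [v] } := by
  have h : Reach A 1 .fin { ans := v } none { out := [v] } :=
    .step rfl rfl (by rintro (k | k | k) <;> cases k <;> rfl)
  refine ((((reach_clrB _).trans (reach_clrC _)).trans (reach_clrM _)).trans h).mono ?_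
  simp only
  omega

/-- The matrix for a list of tokens, given the constraint for each pair of constants. -/
def matrix (l : List (List Bool)) (f : List Bool → List Bool → BoolRel) (i j : ℕ) : BoolRel :=
  f (l.getD i []) (l.getD j [])

theorem matrixText_matrix (l : List (List Bool)) (f : List Bool → List Bool → BoolRel) :
    matrixText (List.range l.length) (List.range l.length) (matrix l f) =
      l.flatMap fun u => l.map (fun w => some (f u w)) ++ [none] := by
  have h : (List.range l.length).map (fun i => l.getD i []) = l :=
    List.ext_getElem (by simp) (by simp +contextual)
  have hm (f : List Bool → Option BoolRel) :
      (List.range l.length).map (fun j => f (l.getD j [])) = l.map f := by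
    conv_rhs => rw [← h, List.map_map]
    rfl
  have hf (f : List Bool → List (Option BoolRel)) :
      (List.range l.length).flatMap (fun j => f (l.getD j [])) = l.flatMap f := by
    conv_rhs => rw [← h, List.flatMap_map]
  rw [← hf]
  simp only [matrixText, matrix, ← hm]

/-- The running time of the machine. -/
def runTime (n : ℕ) : ℕ :=
  n * rowTime n + 4 * n + 5 + (n * (n * (3 * n + 4) + 2 * n + 5) + 1) + (2 * n + n * (n + 1) + 4)

theorem reach_all (A : Scanner S) (ts : List Tok) :
    Reach A (runTime (text ts).length) .copyIn { inp := text ts } none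
      { out := [solve (nums ts).length (matrix (nums ts).reverse (A.entry ts))] } := by
  have hk := (length_nums_le ts).trans (length_le_length_text ts)
  set n := (text ts).length with hn
  set k := (nums ts).length with hk'
  have h₁ := reach_matrix (A := A) ts n le_rfl
  rw [← matrixText_matrix, List.length_reverse] at h₁
  obtain ⟨m, hm, h₂⟩ := reach_elim (A := A) (text ts) (text ts) k
    (matrix (nums ts).reverse (A.entry ts))
  refine ((h₁.trans h₂).trans (reach_fin _ _ _ _)).mono ?_
  have h₃ : k * (k * (3 * k + 4) + 2 * k + 5) ≤ n * (n * (3 * n + 4) + 2 * n + 5) := by gcongr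
  have h₄ : k * (k + 1) ≤ n * (n + 1) := by gcongr
  unfold runTime
  omega

end Runs
-- An automaton that records a database in bounded memory.
/-- Lists of length at most `N`. -/
abbrev Short (α : Type) (N : ℕ) : Type := {l : List α // l.length ≤ N}

instance (α : Type) [Finite α] (N : ℕ) : Finite (Short α N) :=
  (List.finite_length_le α N).to_subtype

/-- Append an element to a list, if this does not make the list too long. -/
def Short.snoc {α : Type} {N : ℕ} (l : Short α N) (x : α) : Short α N :=
  ⟨(l.1 ++ [x]).take N, by simp⟩

/-- The beginning of a list. -/
def Short.of {α : Type} (N : ℕ) (l : List α) : Short α N := ⟨l.take N, by simp⟩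

/-- The empty list. -/
def Short.nil {α : Type} {N : ℕ} : Short α N := Short.of N []

/-- Truncating at every step has the same effect as truncating once at the end, so bounded memory
suffices to know the prefix of length `N`. -/
theorem Short.foldl_snoc {α : Type} {N : ℕ} (l : List α) : ∀ k : List α,
    l.foldl Short.snoc (Short.of N k) = Short.of N (k ++ l) := by
  induction l with
  | nil => simp
  | cons x l ih =>
    intro k
    have h : (Short.of N k).snoc x = Short.of N (k ++ [x]) := by
      apply Subtype.ext
      simp only [Short.snoc, Short.of]
      rcases le_or_gt N k.length with h | h
      · rw [List.take_append_of_le_length (by simp [h]), List.take_append_of_le_length h,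
          List.take_take, min_self]
      · rw [List.take_of_length_le (l := k) h.le]
    rw [List.foldl_cons, h, ih, List.append_assoc, List.singleton_append]

/-- What is recorded of a constant: whether it is equal to each of two given constants, and the
beginning of its binary representation. -/
abbrev Mark (N : ℕ) : Type := Bool × Bool × Short Bool N

/-- The record of the constant `l`, if the given constants are `u` and `w`. -/
def mark (N : ℕ) (u w l : List Bool) : Mark N := (decide (l = u), decide (l = w), Short.of N l)

/-- What is recorded of a database with `m` relations. -/
abbrev Record (m N : ℕ) : Type := Set (Fin (m + 1) × Short (Mark N) N)

/-- The state of the automaton that records a database. -/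
structure ScanState (m N : ℕ) where
  depth : Fin 3 := 0
  rel : Fin (m + 1) := 0
  tuple : Short (Mark N) N := .nil
  bits : Short Bool N := .nil
  acc : Record m N := ∅

instance (m N : ℕ) : Finite (ScanState m N) :=
  Finite.of_injective
    (fun x : ScanState m N => (x.depth, x.rel, x.tuple, x.bits, x.acc))
    (by rintro ⟨⟩ ⟨⟩ h; simpa using h)

/-- The index of a relation, as a state. -/
def relIdx (m k : ℕ) : Fin (m + 1) := ⟨min k m, by omega⟩

/-- The automaton that records a database. -/
def recorder (m N : ℕ) (out : Record m N → BoolRel) : Scanner (ScanState m N) where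
  start := {}
  sym x
    | .bra => { x with depth := x.depth + 1, tuple := .nil, bits := .nil }
    | .ket =>
      if x.depth = 2 then { x with depth := 1, acc := insert (x.rel, x.tuple) x.acc }
      else { x with depth := 0, rel := relIdx m (x.rel + 1) }
    | .bit b => { x with bits := x.bits.snoc b }
    | _ => x
  num x e f := { x with tuple := x.tuple.snoc (e, f, x.bits), bits := .nil }
  out x := out x.acc

/-! ### The text of a listed database and its record. -/

section Tokens

variable {R : Schema}

/-- The tokens of a tuple. -/
def tupleToks {k : ℕ} (t : Fin k → Const) : List Tok :=
  .op :: (((List.ofFn t).map fun c => .num (encodeNat c)) ++ [.cl])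

/-- The tokens of a relation. -/
def relToks {k : ℕ} (l : List (Fin k → Const)) : List Tok :=
  .op :: (l.flatMap tupleToks ++ [.cl])

/-- The tokens of a database. -/
def Listing.toks (L : Listing R) : List Tok :=
  (List.finRange R.numRel).flatMap fun r => relToks (L r)

theorem text_append (l k : List Tok) : text (l ++ k) = text l ++ text k := List.flatMap_append

theorem text_tupleToks {k : ℕ} (t : Fin k → Const) : text (tupleToks t) = encodeTuple t := by
  simp [text, tupleToks, encodeTuple, Tok.text, encodingNatΓ', inclusionBoolΓ',
    List.ofFn_eq_map, List.flatMap_map]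

theorem text_toks (L : Listing R) : text L.toks = L.encode := by
  have h (l : List Tok) : text l = l.flatMap Tok.text := rfl
  simp only [Listing.toks, Listing.encode, h, List.flatMap_assoc]
  congr 1
  funext r
  simp only [relToks, ← h, text_cons, text_append]
  simp only [h, List.flatMap_assoc]
  simp only [← h, text_tupleToks]
  rfl

theorem mem_nums {ts : List Tok} {l : List Bool} : l ∈ nums ts ↔ .num l ∈ ts := by
  induction ts with
  | nil => simp [nums]
  | cons t ts ih => cases t <;> simp [nums, ih]

theorem mem_tupleToks {k : ℕ} {t : Fin k → Const} {l : List Bool} :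
    .num l ∈ tupleToks t ↔ ∃ i, encodeNat (t i) = l := by
  simp [tupleToks]

theorem mem_nums_toks {L : Listing R} {l : List Bool} :
    l ∈ nums L.toks ↔ ∃ c ∈ L.toDatabase.dom, encodeNat c = l := by
  simp only [mem_nums, Listing.toks, relToks, Database.dom, Listing.toDatabase, List.mem_flatMap,
    List.mem_finRange, true_and, List.mem_cons, List.mem_append, reduceCtorEq, false_or,
    List.not_mem_nil, or_false, mem_tupleToks, List.mem_toFinset, Set.mem_ofPred_eq]
  constructor
  · rintro ⟨r, t, ht, i, hi⟩
    exact ⟨t i, ⟨r, t, ht, i, rfl⟩, hi⟩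
  · rintro ⟨c, ⟨r, t, ht, i, rfl⟩, hi⟩
    exact ⟨r, t, ht, i, hi⟩

variable {m N : ℕ} {out : Record m N → BoolRel} {u w : List Bool}

theorem recorder_num (x : ScanState m N) (hx : x.bits = .nil) (l k : List (List Bool))
    (hl : x.tuple = Short.of N (l.map (mark N u w))) :
    (k.map Tok.num).foldl ((recorder m N out).tok u w) x =
      { x with tuple := Short.of N ((l ++ k).map (mark N u w)) } := by
  induction k generalizing x l with
  | nil => simp [← hl]
  | cons b k ih =>
    have hb (b : List Bool) (x : ScanState m N) :
        b.foldl (fun d b => (recorder m N out).sym d (.bit b)) x =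
          { x with bits := b.foldl Short.snoc x.bits } := by
      induction b generalizing x with
      | nil => rfl
      | cons c b ih => exact ih _
    have h₁ : (recorder m N out).tok u w x (.num b) =
        { x with tuple := Short.of N ((l ++ [b]).map (mark N u w)) } := by
      have h₂ : b.foldl Short.snoc x.bits = Short.of N b := by
        rw [hx]
        exact Short.foldl_snoc b []
      have h₃ : (Short.of N (l.map (mark N u w))).snoc (mark N u w b) =
          Short.of N ((l ++ [b]).map (mark N u w)) := by
        have := Short.foldl_snoc (N := N) [mark N u w b] (l.map (mark N u w))
        simpa using this
      simp only [Scanner.tok, hb, h₂]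
      rw [← h₃, ← hl]
      simp only [recorder, mark]
      rw [← hx]
    rw [List.map_cons, List.foldl_cons, h₁,
      ih { x with tuple := Short.of N ((l ++ [b]).map (mark N u w)) } hx (l ++ [b]) rfl]
    simp

/-- The record of a tuple. -/
def markTuple (N : ℕ) (u w : List Bool) {k : ℕ} (t : Fin k → Const) : Short (Mark N) N :=
  Short.of N ((List.ofFn t).map fun c => mark N u w (encodeNat c))

/-- The tuple register keeps stale content after the closing bracket. The next opening bracket
clears it, so its value `p'` is left unspecified. -/
theorem recorder_tuple {k : ℕ} (t : Fin k → Const) (i : Fin (m + 1)) (acc : Record m N)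
    (p : Short (Mark N) N) : ∃ p',
    (tupleToks t).foldl ((recorder m N out).tok u w)
      { depth := 1, rel := i, tuple := p, acc := acc } =
    { depth := 1, rel := i, tuple := p', acc := insert (i, markTuple N u w t) acc } := by
  have h := recorder_num (out := out) (u := u) (w := w)
    ({ depth := 2, rel := i, acc := acc } : ScanState m N) rfl []
    ((List.ofFn t).map encodeNat) rfl
  rw [List.map_map, List.nil_append, List.map_map] at h
  refine ⟨markTuple N u w t, ?_⟩
  rw [tupleToks, List.foldl_cons, List.foldl_append]
  exact congrArg (fun x => (recorder m N out).tok u w x .cl) h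

theorem recorder_tuples {k : ℕ} (l : List (Fin k → Const)) (i : Fin (m + 1)) (acc : Record m N)
    (p : Short (Mark N) N) : ∃ p',
    (l.flatMap tupleToks).foldl ((recorder m N out).tok u w)
      { depth := 1, rel := i, tuple := p, acc := acc } =
    { depth := 1, rel := i, tuple := p',
      acc := acc ∪ {x | ∃ t ∈ l, x = (i, markTuple N u w t)} } := by
  induction l generalizing acc p with
  | nil => exact ⟨p, by simp⟩
  | cons t l ih =>
    obtain ⟨p₁, h₁⟩ := recorder_tuple (out := out) (u := u) (w := w) t i acc p
    obtain ⟨p₂, h₂⟩ := ih (insert (i, markTuple N u w t) acc) p₁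
    refine ⟨p₂, ?_⟩
    rw [List.flatMap_cons, List.foldl_append, h₁, h₂]
    congr 1
    ext x
    simp
    tauto

theorem recorder_rels (L : Listing R) (rs : List (Fin R.numRel)) (k : ℕ)
    (hk : ∀ i (h : i < rs.length), (rs[i] : ℕ) = k + i) (out : Record R.numRel N → BoolRel)
    (acc : Record R.numRel N) (p : Short (Mark N) N) : ∃ i p',
    (rs.flatMap fun r => relToks (L r)).foldl ((recorder R.numRel N out).tok u w)
      { rel := relIdx _ k, tuple := p, acc := acc } =
    { rel := i, tuple := p',
      acc := acc ∪ {x | ∃ r ∈ rs, ∃ t ∈ L r, x = (relIdx _ r, markTuple N u w t)} } := by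
  induction rs generalizing k acc p with
  | nil => exact ⟨relIdx _ k, p, by simp⟩
  | cons r rs ih =>
    have hr : (r : ℕ) = k := hk 0 (by simp)
    obtain ⟨p₁, h₁⟩ := recorder_tuples (out := out) (u := u) (w := w) (L r) (relIdx _ k) acc .nil
    obtain ⟨i, p₂, h₂⟩ := ih (k + 1) (fun i h => by
      have := hk (i + 1) (by simpa using h)
      simp only [List.getElem_cons_succ] at this
      omega) (acc ∪ {x | ∃ t ∈ L r, x = (relIdx _ k, markTuple N u w t)}) p₁
    refine ⟨i, p₂, ?_⟩
    have h₃ : (relToks (L r)).foldl ((recorder R.numRel N out).tok u w)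
        { rel := relIdx _ k, tuple := p, acc := acc } =
        { rel := relIdx _ (k + 1), tuple := p₁,
          acc := acc ∪ {x | ∃ t ∈ L r, x = (relIdx _ k, markTuple N u w t)} } := by
      have hi : relIdx R.numRel ((relIdx R.numRel k : ℕ) + 1) = relIdx R.numRel (k + 1) := by
        simp only [relIdx, Fin.mk.injEq]
        omega
      rw [← hi, relToks, List.foldl_cons, List.foldl_append]
      exact congrArg (fun x => (recorder R.numRel N out).tok u w x .cl) h₁
    rw [List.flatMap_cons, List.foldl_append, h₃, h₂]
    congr 1
    ext x
    simp [hr, or_assoc]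

/-- The record of a database. -/
def Listing.record (L : Listing R) (N : ℕ) (u w : List Bool) : Record R.numRel N :=
  {x | ∃ r, ∃ t ∈ L r, x = (relIdx _ r, markTuple N u w t)}

/-- The outcome of a scan depends on the text only through a subset of a fixed finite type; order
and repetition of the tuples are forgotten. -/
theorem entry_recorder (L : Listing R) (N : ℕ) (out : Record R.numRel N → BoolRel)
    (u w : List Bool) :
    (recorder R.numRel N out).entry L.toks u w = out (L.record N u w) := by
  obtain ⟨i, p, h⟩ := recorder_rels (N := N) (u := u) (w := w) L (List.finRange R.numRel) 0
    (by simp) out ∅ .nil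
  have h₀ : relIdx R.numRel 0 = 0 := by ext; simp [relIdx]
  rw [h₀] at h
  rw [Scanner.entry, Listing.toks]
  refine (congrArg (recorder R.numRel N out).out h).trans ?_
  simp [recorder, Listing.record]

end Tokens
-- From algebra expressions to quantifier-free formulas.
/-- Quantifier-free formulas in two variables (named by the Booleans) over a relational vocabulary
and one more relation name of arity `s`. -/
inductive Fm (R : Schema) (s : ℕ) : Type
  | rel (r : Fin R.numRel) (args : Fin (R.arity r) → Bool ⊕ Const)
  | guess (args : Fin s → Bool)
  | eq (x y : Bool ⊕ Const)
  | tt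
  | not (φ : Fm R s)
  | and (φ ψ : Fm R s)
  | or (φ ψ : Fm R s)

variable {R : Schema} {s : ℕ}

/-- Interpretations of the atoms over the database. -/
structure Atoms (R : Schema) where
  rel : ∀ r : Fin R.numRel, (Fin (R.arity r) → Bool ⊕ Const) → Prop
  eq : Bool ⊕ Const → Bool ⊕ Const → Prop

/-- Exchange the two variables. -/
def swapVar : Bool ⊕ Const → Bool ⊕ Const := Sum.map Bool.not id

/-- Exchange the two variables. -/
def Atoms.swap (I : Atoms R) : Atoms R where
  rel r args := I.rel r fun i => swapVar (args i)
  eq x y := I.eq (swapVar x) (swapVar y)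

/-- Truth of a formula, if the truth values of the atoms are given. -/
def Fm.Sat (I : Atoms R) (h : (Fin s → Bool) → Prop) : Fm R s → Prop
  | .rel r args => I.rel r args
  | .guess args => h args
  | .eq x y => I.eq x y
  | .tt => True
  | .not φ => ¬ φ.Sat I h
  | .and φ ψ => φ.Sat I h ∧ ψ.Sat I h
  | .or φ ψ => φ.Sat I h ∨ ψ.Sat I h

/-- The value of a term. -/
def val (g : Bool → Const) : Bool ⊕ Const → Const := Sum.elim g id

/-- The truth values of the atoms in a database. -/
def Database.atoms (D : Database R) (g : Bool → Const) : Atoms R where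
  rel r args := (fun i => val g (args i)) ∈ D r
  eq x y := val g x = val g y

theorem Cond.exists_fm {U : Finset Attr} (c : Cond U) (f : U → Bool) :
    ∃ φ : Fm R s, ∀ (D : Database R) (g : Bool → Const) (h : (Fin s → Bool) → Prop),
      c.Holds (fun a => g (f a)) ↔ φ.Sat (D.atoms g) h := by
  induction c with
  | eq x y =>
    refine ⟨.eq (x.map f id) (y.map f id), fun D g h => ?_⟩
    rcases x with x | x <;> rcases y with y | y <;> rfl
  | not c ih =>
    obtain ⟨φ, hφ⟩ := ih
    exact ⟨.not φ, fun D g h => not_congr (hφ D g h)⟩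
  | and c d ihc ihd =>
    obtain ⟨φ, hφ⟩ := ihc
    obtain ⟨ψ, hψ⟩ := ihd
    exact ⟨.and φ ψ, fun D g h => and_congr (hφ D g h) (hψ D g h)⟩
  | or c d ihc ihd =>
    obtain ⟨φ, hφ⟩ := ihc
    obtain ⟨ψ, hψ⟩ := ihd
    exact ⟨.or φ ψ, fun D g h => or_congr (hφ D g h) (hψ D g h)⟩

/-- Every operator but projection can be evaluated at a single tuple, so membership is a Boolean
combination of atoms. The map `f` from attributes to variables is arbitrary because renamings and
joins are absorbed by changing it. Powers of `DOM` become `tt`, as the variables range over `A`. -/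
theorem RAExpr.exists_fm {U : Finset Attr} (E : RAExpr (vocab R (single s)) U) (hq : E.QFree)
    (hc : E.NoConstArgs (Set.range Sum.inr)) (f : U → Bool) :
    ∃ φ : Fm R s, ∀ (D : Database R) (A : Set Const)
      (ext : ∀ q, Set (Fin ((single s).arity q) → Const)) (g : Bool → Const), (∀ b, g b ∈ A) →
      ((fun a => g (f a)) ∈ E.eval (interp D ext) A ↔
        φ.Sat (D.atoms g) fun args => (fun i => g (args i)) ∈ ext 0) := by
  induction E with
  | @rel U r args hargs =>
    rcases r with r | r
    · refine ⟨.rel r fun i => (args i).map f id, fun D A ext g hg => ?_⟩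
      have h : (fun i => termVal (fun a => g (f a)) (args i)) =
          fun i => val g ((args i).map f id) := by
        funext i
        rcases args i with x | x <;> rfl
      change (fun i => termVal (fun a => g (f a)) (args i)) ∈ D r ↔ _
      rw [h]
      rfl
    · have hc' (i) : (args i).isLeft := hc ⟨r, rfl⟩ i
      obtain rfl : r = 0 := Subsingleton.elim _ _
      refine ⟨.guess fun i => f ((args i).getLeft (hc' i)), fun D A ext g hg => ?_⟩
      have h : (fun i => termVal (fun a => g (f a)) (args i)) =
          fun i => g (f ((args i).getLeft (hc' i))) := by
        funext i
        conv_lhs => rw [← Sum.inl_getLeft (args i) (hc' i)]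
        rfl
      change (fun i => termVal (fun a => g (f a)) (args i)) ∈ ext 0 ↔ _
      rw [h]
      rfl
  | dom U => exact ⟨.tt, fun D A ext g hg => iff_of_true (fun a => hg _) trivial⟩
  | select c E ih =>
    obtain ⟨φ, hφ⟩ := ih hq hc f
    obtain ⟨ψ, hψ⟩ := c.exists_fm (R := R) (s := s) f
    exact ⟨.and φ ψ, fun D A ext g hg => and_congr (hφ D A ext g hg) (hψ D g _)⟩
  | project V hV E ih => exact hq.elim
  | rename ρ E ih =>
    obtain ⟨φ, hφ⟩ := ih hq hc fun a => f (ρ a)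
    exact ⟨φ, fun D A ext g hg => hφ D A ext g hg⟩
  | join E F ihE ihF =>
    obtain ⟨φ, hφ⟩ := ihE hq.1 hc.1 fun a => f ⟨a.1, Finset.mem_union_left _ a.2⟩
    obtain ⟨ψ, hψ⟩ := ihF hq.2 hc.2 fun a => f ⟨a.1, Finset.mem_union_right _ a.2⟩
    exact ⟨.and φ ψ, fun D A ext g hg => and_congr (hφ D A ext g hg) (hψ D A ext g hg)⟩
  | equijoin E F m hm ihE ihF =>
    obtain ⟨φ, hφ⟩ := ihE hq.1 hc.1 fun a => f ⟨a.1, Finset.mem_union_left _ a.2⟩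
    obtain ⟨ψ, hψ⟩ := ihF hq.2 hc.2 fun a => f ⟨m a, Finset.mem_union_right _
      (Finset.mem_image_of_mem m (Finset.mem_univ a))⟩
    exact ⟨.and φ ψ, fun D A ext g hg => and_congr (hφ D A ext g hg) (hψ D A ext g hg)⟩
  | union E F ihE ihF =>
    obtain ⟨φ, hφ⟩ := ihE hq.1 hc.1 f
    obtain ⟨ψ, hψ⟩ := ihF hq.2 hc.2 f
    exact ⟨.or φ ψ, fun D A ext g hg => or_congr (hφ D A ext g hg) (hψ D A ext g hg)⟩
  | inter E F ihE ihF =>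
    obtain ⟨φ, hφ⟩ := ihE hq.1 hc.1 f
    obtain ⟨ψ, hψ⟩ := ihF hq.2 hc.2 f
    exact ⟨.and φ ψ, fun D A ext g hg => and_congr (hφ D A ext g hg) (hψ D A ext g hg)⟩
  | diff E F ihE ihF =>
    obtain ⟨φ, hφ⟩ := ihE hq.1 hc.1 f
    obtain ⟨ψ, hψ⟩ := ihF hq.2 hc.2 f
    exact ⟨.and φ (.not ψ), fun D A ext g hg =>
      and_congr (hφ D A ext g hg) (not_congr (hψ D A ext g hg))⟩

/-- The query asks for an extension that satisfies a quantifier-free formula, for all values of its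
two variables. -/
theorem exists_fm_holds {U : Finset Attr} (Y₁ Y₂ : Attr) (h₁ : Y₁ ∈ U) (h₂ : Y₂ ∈ U)
    (hne : Y₁ ≠ Y₂) (hU : ∀ a ∈ U, a = Y₁ ∨ a = Y₂) (PHI : RAExpr (vocab R (single s)) U)
    (hq : PHI.QFree) (hc : PHI.NoConstArgs (Set.range Sum.inr)) :
    ∃ φ : Fm R s, ∀ D : Database R, (pairQuery Y₁ Y₂ h₁ h₂ PHI).Holds D ↔
      ∃ ext : Set (Fin s → Const), (∀ t ∈ ext, ∀ i, t i ∈ D.dom) ∧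
        ∀ g : Bool → Const, (∀ b, g b ∈ D.dom) →
          φ.Sat (D.atoms g) fun args => (fun i => g (args i)) ∈ ext := by
  obtain ⟨φ, hφ⟩ := PHI.exists_fm hq hc fun a => decide (a.1 = Y₂)
  refine ⟨φ, fun D => ?_⟩
  have key (ext : ∀ q, Set (Fin ((single s).arity q) → Const)) :
      (pairQuery Y₁ Y₂ h₁ h₂ PHI).fail.eval (interp D ext) D.dom = ∅ ↔
        ∀ g : Bool → Const, (∀ b, g b ∈ D.dom) →
          φ.Sat (D.atoms g) fun args => (fun i => g (args i)) ∈ ext 0 := by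
    rw [Set.eq_empty_iff_forall_notMem]
    constructor
    · intro h g hg
      rw [← hφ D D.dom ext g hg]
      by_contra hne'
      refine h (fun a => g (decide (a.1 = Y₂))) ⟨⟨fun a => hg _, fun a => hg _⟩, ?_⟩
      rintro ⟨u, hu, hu'⟩
      -- `U` has no attributes besides `Y₁` and `Y₂`, so the outer projection identifies no two
      -- tuples.
      have : u = fun a => g (decide (a.1 = Y₂)) := by
        funext a
        exact (hu' ⟨a.1, by have := hU a.1 a.2; simpa using this⟩).symm
      exact hne' (this ▸ hu)
    · rintro h t ⟨⟨ht₁, ht₂⟩, ht⟩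
      let t₁ : Const := t ⟨Y₁, by simp⟩
      let t₂ : Const := t ⟨Y₂, by simp⟩
      have hg : ∀ b, (bif b then t₂ else t₁) ∈ D.dom := by
        rintro (_ | _)
        · exact ht₁ ⟨Y₁, by simp⟩
        · exact ht₂ ⟨Y₂, by simp⟩
      refine ht ⟨_, (hφ D D.dom ext (fun b => bif b then t₂ else t₁) hg).2 (h _ hg), ?_⟩
      rintro ⟨a, ha⟩
      have ha' : a = Y₁ ∨ a = Y₂ := by simpa using ha
      rcases ha' with rfl | rfl
      · simp [hne, t₁]
      · simp [t₂]
  constructor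
  · rintro ⟨ext, hext, h⟩
    exact ⟨ext 0, hext 0, (key ext).1 h⟩
  · rintro ⟨ext, hext, h⟩
    exact ⟨fun _ => ext, fun _ => hext, (key fun _ => ext).2 h⟩

/-! ### Decoupling the guess into binary constraints. -/

/-- The assignment of two constants to the variables. -/
def pair (a b : Const) : Bool → Const := fun x => bif x then b else a

theorem Database.atoms_swap (D : Database R) (a b : Const) :
    (D.atoms (pair a b)).swap = D.atoms (pair b a) := by
  have h (x) : val (pair a b) (swapVar x) = val (pair b a) x := by
    rcases x with (_ | _) | x <;> rfl
  simp only [Database.atoms, Atoms.swap, h]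

/-- The constraint that a formula poses on the truth values of the guessed relation at the
constant tuples of the two variables. -/
def Fm.Constraint (φ : Fm R s) (I : Atoms R) (p q : Bool) : Prop :=
  (I.eq (.inl false) (.inl true) → p = q ∧ φ.Sat I fun _ => p = true) ∧
  (¬ I.eq (.inl false) (.inl true) → ∃ h : (Fin s → Bool) → Bool,
    (h fun _ => false) = p ∧ (h fun _ => true) = q ∧ φ.Sat I (fun w => h w = true) ∧
      φ.Sat I.swap fun w => h (fun i => !w i) = true)

theorem Fm.constraint_self (φ : Fm R s) (D : Database R) (a : Const) (p q : Bool) :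
    φ.Constraint (D.atoms (pair a a)) p q ↔
      p = q ∧ φ.Sat (D.atoms (pair a a)) fun _ => p = true :=
  ⟨fun h => h.1 rfl, fun h => ⟨fun _ => h, fun h' => (h' rfl).elim⟩⟩

theorem Fm.constraint_of_ne (φ : Fm R s) (D : Database R) {a b : Const} (hab : a ≠ b)
    (p q : Bool) : φ.Constraint (D.atoms (pair a b)) p q ↔ ∃ h : (Fin s → Bool) → Bool,
      (h fun _ => false) = p ∧ (h fun _ => true) = q ∧
        φ.Sat (D.atoms (pair a b)) (fun w => h w = true) ∧
        φ.Sat (D.atoms (pair b a)) fun w => h (fun i => !w i) = true := by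
  rw [← D.atoms_swap a b]
  exact ⟨fun h => h.2 hab, fun h => ⟨fun h' => (hab h').elim, fun _ => h⟩⟩

/-- For distinct constants both orders of the pair are imposed at once, and complementing the index
`w` exchanges them. This supplies the symmetry that the elimination needs. -/
theorem Fm.constraint_comm (φ : Fm R s) (D : Database R) (a b : Const) (p q : Bool) :
    φ.Constraint (D.atoms (pair a b)) p q ↔ φ.Constraint (D.atoms (pair b a)) q p := by
  by_cases hab : a = b
  · subst hab
    simp only [Fm.constraint_self]
    constructor <;> (rintro ⟨rfl, h⟩; exact ⟨rfl, h⟩)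
  · have key (a b : Const) (hab : a ≠ b) (p q : Bool) :
        φ.Constraint (D.atoms (pair a b)) p q → φ.Constraint (D.atoms (pair b a)) q p := by
      rw [φ.constraint_of_ne D hab, φ.constraint_of_ne D hab.symm]
      rintro ⟨h, h₁, h₂, h₃, h₄⟩
      exact ⟨fun w => h fun i => !w i, h₂, h₁, h₄, by simpa using h₃⟩
    exact ⟨key a b hab p q, key b a (Ne.symm hab) q p⟩

/-- A nonconstant tuple has exactly its two constants as entries, and their order tells which one
belongs to `false`. Hence the choices made for different pairs cannot conflict. -/
theorem pair_comp_inj {a b c d : Const} (hab : a < b) (hcd : c < d) {w w' : Fin s → Bool}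
    (hw : ∃ i j, w i ≠ w j) (h : (fun i => pair a b (w i)) = fun i => pair c d (w' i)) :
    a = c ∧ b = d ∧ w = w' := by
  obtain ⟨i, j, hij⟩ : ∃ i j, w i = false ∧ w j = true := by
    obtain ⟨i, j, hij⟩ := hw
    cases hi : w i <;> cases hj : w j
    · simp_all
    · exact ⟨i, j, hi, hj⟩
    · exact ⟨j, i, hj, hi⟩
    · simp_all
  have h' (i) : pair a b (w i) = pair c d (w' i) := congrFun h i
  have hi := h' i
  have hj := h' j
  rw [hij.1] at hi
  rw [hij.2] at hj
  obtain ⟨rfl, rfl⟩ : a = c ∧ b = d := by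
    cases hi' : w' i <;> cases hj' : w' j <;>
      simp only [pair, hi', hj', cond_true, cond_false] at hi hj <;> constructor <;> order
  refine ⟨rfl, rfl, funext fun i => ?_⟩
  have := h' i
  cases hi : w i <;> cases hj : w' i <;> simp only [pair, hi, hj, cond_true, cond_false] at this <;>
    first | rfl | order

/-- Guessing a relation amounts to solving a system of binary Boolean constraints. -/
theorem exists_ext_iff (hs : 0 < s) (φ : Fm R s) (D : Database R) :
    (∃ ext : Set (Fin s → Const), (∀ t ∈ ext, ∀ i, t i ∈ D.dom) ∧
      ∀ g : Bool → Const, (∀ b, g b ∈ D.dom) →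
        φ.Sat (D.atoms g) fun args => (fun i => g (args i)) ∈ ext) ↔
    ∃ v : Const → Bool, ∀ a ∈ D.dom, ∀ b ∈ D.dom,
      φ.Constraint (D.atoms (pair a b)) (v a) (v b) := by
  classical
  have hpair {a b : Const} (ha : a ∈ D.dom) (hb : b ∈ D.dom) (x : Bool) : pair a b x ∈ D.dom := by
    cases x
    exacts [ha, hb]
  constructor
  · rintro ⟨ext, hext, h⟩
    -- The variable of `a` is the truth value of `Q` at the constant tuple of `a`.
    refine ⟨fun a => decide ((fun _ => a) ∈ ext), fun a ha b hb => ?_⟩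
    by_cases hab : a = b
    · subst hab
      rw [φ.constraint_self]
      refine ⟨rfl, ?_⟩
      have := h (pair a a) (hpair ha ha)
      have h' (x : Bool) : pair a a x = a := by cases x <;> rfl
      simpa only [h', decide_eq_true_eq] using this
    · rw [φ.constraint_of_ne D hab]
      refine ⟨fun w => decide ((fun i => pair a b (w i)) ∈ ext), rfl, rfl, ?_, ?_⟩
      · simpa only [decide_eq_true_eq] using h (pair a b) (hpair ha hb)
      · have h' (x : Bool) : pair a b (!x) = pair b a x := by cases x <;> rfl
        simpa only [decide_eq_true_eq, h'] using h (pair b a) (hpair hb ha)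
  · rintro ⟨v, hv⟩
    -- Restricting to `a < b` makes one choice of truth values for each unordered pair.
    have hex (a b : Const) (ha : a ∈ D.dom) (hb : b ∈ D.dom) (hab : a < b) :=
      (φ.constraint_of_ne D hab.ne _ _).1 (hv a ha b hb)
    choose h h₁ h₂ h₃ h₄ using hex
    let i₀ : Fin s := ⟨0, hs⟩
    -- Constant tuples are governed by `v`, nonconstant ones by the choice for their unique pair.
    refine ⟨{t | (∃ a, a ∈ D.dom ∧ t = (fun _ => a) ∧ v a = true) ∨
      ∃ a b, ∃ (ha : a ∈ D.dom) (hb : b ∈ D.dom) (hab : a < b) (w : Fin s → Bool),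
        (∃ i j, w i ≠ w j) ∧ t = (fun i => pair a b (w i)) ∧ h a b ha hb hab w = true}, ?_, ?_⟩
    · rintro t (⟨a, ha, rfl, -⟩ | ⟨a, b, ha, hb, -, w, -, rfl, -⟩) i
      exacts [ha, hpair ha hb _]
    · have hconst (a : Const) (ha : a ∈ D.dom) : ((fun _ : Fin s => a) ∈ {t : Fin s → Const |
          (∃ a, a ∈ D.dom ∧ t = (fun _ => a) ∧ v a = true) ∨
          ∃ a b, ∃ (ha : a ∈ D.dom) (hb : b ∈ D.dom) (hab : a < b) (w : Fin s → Bool),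
            (∃ i j, w i ≠ w j) ∧ t = (fun i => pair a b (w i)) ∧ h a b ha hb hab w = true}) ↔
          v a = true := by
        constructor
        · rintro (⟨b, -, hb, hb'⟩ | ⟨b, c, -, -, hbc, w, ⟨i, j, hij⟩, hw, -⟩)
          · rwa [show a = b from congrFun hb i₀]
          · have hi : a = pair b c (w i) := congrFun hw i
            have hj : a = pair b c (w j) := congrFun hw j
            exfalso
            cases hi' : w i <;> cases hj' : w j <;>
              simp only [pair, hi', hj', cond_true, cond_false] at hi hj hij <;>
              first | exact hij rfl | order
        · exact fun h => .inl ⟨a, ha, rfl, h⟩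
      have hmem (a b : Const) (ha : a ∈ D.dom) (hb : b ∈ D.dom) (hab : a < b) (w : Fin s → Bool) :
          ((fun i => pair a b (w i)) ∈ {t : Fin s → Const |
          (∃ a, a ∈ D.dom ∧ t = (fun _ => a) ∧ v a = true) ∨
          ∃ a b, ∃ (ha : a ∈ D.dom) (hb : b ∈ D.dom) (hab : a < b) (w : Fin s → Bool),
            (∃ i j, w i ≠ w j) ∧ t = (fun i => pair a b (w i)) ∧ h a b ha hb hab w = true}) ↔
          h a b ha hb hab w = true := by
        by_cases hw : ∃ i j, w i ≠ w j
        · constructor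
          · rintro (⟨c, -, hc, -⟩ | ⟨c, d, hc, hd, hcd, w', -, hw', hh⟩)
            · obtain ⟨i, j, hij⟩ := hw
              have hi : pair a b (w i) = c := congrFun hc i
              have hj : pair a b (w j) = c := congrFun hc j
              exfalso
              cases hi' : w i <;> cases hj' : w j <;>
                simp only [pair, hi', hj', cond_true, cond_false] at hi hj hij <;>
                first | exact hij rfl | order
            · obtain ⟨rfl, rfl, rfl⟩ := pair_comp_inj hab hcd hw hw'
              exact hh
          · exact fun hh => .inr ⟨a, b, ha, hb, hab, w, hw, rfl, hh⟩
        -- At a constant index the chosen `h` has the prescribed value of `v`, so the two clauses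
        -- agree there.
        · push Not at hw
          obtain ⟨x, rfl⟩ : ∃ x, w = fun _ => x := ⟨w i₀, funext fun i => hw i i₀⟩
          cases x
          · exact (hconst a ha).trans (by rw [h₁])
          · exact (hconst b hb).trans (by rw [h₂])
      intro g hg
      obtain ⟨a, b, rfl⟩ : ∃ a b, g = pair a b :=
        ⟨g false, g true, funext fun x => by cases x <;> rfl⟩
      have ha : a ∈ D.dom := hg false
      have hb : b ∈ D.dom := hg true
      rcases lt_trichotomy a b with hab | rfl | hab
      · simpa only [hmem a b ha hb hab] using h₃ a b ha hb hab
      · have h' (x : Bool) : pair a a x = a := by cases x <;> rfl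
        simp only [h', hconst a ha]
        exact ((φ.constraint_self D a _ _).1 (hv a ha a ha)).2
      -- The reversed order is the second half of the constraint for the pair `b < a`.
      · have h' (w : Fin s → Bool) : (fun i => pair a b (w i)) = fun i => pair b a (!w i) := by
          funext i
          cases w i <;> rfl
        simp only [h', hmem b a hb ha hab]
        exact h₄ b a hb ha hab

/-! ### Computing the constraints from records. -/

section Records

variable {R : Schema} {s : ℕ} {N : ℕ}

/-- Does a term have the value of a constant, judging by the record of the constant? -/
def test : Bool ⊕ Const → Mark N → Prop
  | .inl false, x => x.1 = true
  | .inl true, x => x.2.1 = true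
  | .inr c, x => x.2.2.1 = encodeNat c

/-- The truth values of the atoms, judging by the record of a database. -/
def recordAtoms (acc : Record R.numRel N) : Atoms R where
  rel r args := ∃ l, (relIdx _ r, l) ∈ acc ∧ List.Forall₂ test (List.ofFn args) l.1
  eq x y := (∃ c, x = .inr c ∧ y = .inr c) ∨ ∃ p ∈ acc, ∃ z ∈ p.2.1, test x z ∧ test y z

/-- Terms whose constants have short binary representations. -/
def IsShort (N : ℕ) : Bool ⊕ Const → Prop
  | .inl _ => True
  | .inr c => (encodeNat c).length < N

/-- Formulas whose constants have short binary representations. -/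
def Fm.IsShort (N : ℕ) : Fm R s → Prop
  | .rel _ args => ∀ i, NPAlg.IsShort N (args i)
  | .guess _ => True
  | .eq x y => NPAlg.IsShort N x ∧ NPAlg.IsShort N y
  | .tt => True
  | .not φ => φ.IsShort N
  | .and φ ψ => φ.IsShort N ∧ ψ.IsShort N
  | .or φ ψ => φ.IsShort N ∧ ψ.IsShort N

theorem IsShort.mono {M : ℕ} {x : Bool ⊕ Const} (h : IsShort N x) (hN : N ≤ M) : IsShort M x := by
  cases x with
  | inl b => trivial
  | inr c => exact lt_of_lt_of_le h hN

theorem exists_isShort (x : Bool ⊕ Const) : ∃ N, IsShort N x := by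
  cases x with
  | inl b => exact ⟨0, trivial⟩
  | inr c => exact ⟨_, Nat.lt_succ_self _⟩

theorem Fm.IsShort.mono {M : ℕ} {φ : Fm R s} (h : φ.IsShort N) (hN : N ≤ M) : φ.IsShort M := by
  induction φ with
  | rel r args => exact fun i => (h i).mono hN
  | eq x y => exact ⟨h.1.mono hN, h.2.mono hN⟩
  | guess | tt => trivial
  | not φ ih => exact ih h
  | and φ ψ ih ih' | or φ ψ ih ih' => exact ⟨ih h.1, ih' h.2⟩

theorem Fm.exists_isShort (φ : Fm R s) : ∃ N, φ.IsShort N := by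
  induction φ with
  | rel r args =>
    choose N hN using fun i => NPAlg.exists_isShort (args i)
    exact ⟨∑ i, N i, fun i =>
      (hN i).mono (Finset.single_le_sum (fun _ _ => Nat.zero_le _) (Finset.mem_univ i))⟩
  | eq x y =>
    obtain ⟨N, hN⟩ := NPAlg.exists_isShort x
    obtain ⟨M, hM⟩ := NPAlg.exists_isShort y
    exact ⟨max N M, hN.mono (le_max_left _ _), hM.mono (le_max_right _ _)⟩
  | guess | tt => exact ⟨0, trivial⟩
  | not φ ih => exact ih
  | and φ ψ ih ih' | or φ ψ ih ih' =>
    obtain ⟨N, hN⟩ := ih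
    obtain ⟨M, hM⟩ := ih'
    exact ⟨max N M, hN.mono (le_max_left _ _), hM.mono (le_max_right _ _)⟩

/-- The atoms with short constants have the same truth values. -/
structure Atoms.Agree (N : ℕ) (I J : Atoms R) : Prop where
  rel : ∀ r args, (∀ i, IsShort N (args i)) → (I.rel r args ↔ J.rel r args)
  eq : ∀ x y, IsShort N x → IsShort N y → (I.eq x y ↔ J.eq x y)

theorem isShort_swapVar {x : Bool ⊕ Const} (h : IsShort N x) : IsShort N (swapVar x) := by
  cases x <;> exact h

theorem Atoms.Agree.swap {I J : Atoms R} (h : I.Agree N J) : I.swap.Agree N J.swap where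
  rel r _ ha := h.rel r _ fun i => isShort_swapVar (ha i)
  eq _ _ hx hy := h.eq _ _ (isShort_swapVar hx) (isShort_swapVar hy)

theorem Fm.sat_congr {I J : Atoms R} (h : I.Agree N J) {φ : Fm R s} (hφ : φ.IsShort N)
    (f : (Fin s → Bool) → Prop) : φ.Sat I f ↔ φ.Sat J f := by
  induction φ with
  | rel r args => exact h.rel r args hφ
  | eq x y => exact h.eq x y hφ.1 hφ.2
  | guess | tt => exact Iff.rfl
  | not φ ih => exact not_congr (ih hφ)
  | and φ ψ ih ih' => exact and_congr (ih hφ.1) (ih' hφ.2)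
  | or φ ψ ih ih' => exact or_congr (ih hφ.1) (ih' hφ.2)

theorem Fm.constraint_congr {I J : Atoms R} (h : I.Agree N J) {φ : Fm R s} (hφ : φ.IsShort N)
    (p q : Bool) : φ.Constraint I p q ↔ φ.Constraint J p q := by
  simp only [Fm.Constraint, Fm.sat_congr h hφ, Fm.sat_congr h.swap hφ,
    h.eq (.inl false) (.inl true) trivial trivial]

theorem encodeNat_injective : Function.Injective encodeNat :=
  Function.LeftInverse.injective decode_encodeNat

/-- A prefix of length at most `N` that equals a string shorter than `N` has lost nothing by
truncation; this is why `IsShort` is strict. -/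
theorem test_mark {a b c : Const} {x : Bool ⊕ Const} (hx : IsShort N x) :
    test x (mark N (encodeNat a) (encodeNat b) (encodeNat c)) ↔ c = val (pair a b) x := by
  rcases x with (_ | _) | d
  · simp [test, mark, val, pair, encodeNat_injective.eq_iff]
  · simp [test, mark, val, pair, encodeNat_injective.eq_iff]
  · simp only [test, mark, Short.of, val, Sum.elim_inr, id_eq]
    constructor
    · intro h
      have h' : ((encodeNat c).take N).length < N := by rw [h]; exact hx
      rw [List.length_take] at h'
      rw [List.take_of_length_le (by omega)] at h
      exact encodeNat_injective h
    · rintro rfl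
      exact List.take_of_length_le (le_of_lt hx)

theorem markTuple_val {k : ℕ} (hk : k ≤ N) (u w : List Bool) (t : Fin k → Const) :
    (markTuple N u w t).1 = List.ofFn fun i => mark N u w (encodeNat (t i)) := by
  simp only [markTuple, Short.of]
  rw [List.take_of_length_le (by simpa using hk), List.map_ofFn]
  rfl

theorem forall₂_ofFn {α β : Type} (r : α → β → Prop) {k : ℕ} (f : Fin k → α) (g : Fin k → β) :
    List.Forall₂ r (List.ofFn f) (List.ofFn g) ↔ ∀ i, r (f i) (g i) := by
  rw [List.forall₂_iff_get]
  simp [Fin.forall_iff]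

theorem relIdx_inj {m : ℕ} {i j : Fin m} : relIdx m i = relIdx m j ↔ i = j := by
  simp only [relIdx, Fin.ext_iff]
  omega

/-- The record knows only constants that occur in the database. An equality that involves a variable
is witnessed by an occurrence of the common value, since `a` and `b` lie in `DOM`. An equality
between two constants of the formula, which need not occur, is decided syntactically. -/
theorem agree_record (L : Listing R) (hN : ∀ r, R.arity r ≤ N) {a b : Const}
    (ha : a ∈ L.toDatabase.dom) (hb : b ∈ L.toDatabase.dom) :
    (recordAtoms (L.record N (encodeNat a) (encodeNat b))).Agree N
      (L.toDatabase.atoms (pair a b)) where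
  rel r args hargs := by
    have h : (L.toDatabase.atoms (pair a b)).rel r args ↔
        (fun i => val (pair a b) (args i)) ∈ L r := List.mem_toFinset
    rw [h]
    constructor
    · rintro ⟨l, ⟨r', t, ht, hl⟩, hl'⟩
      rw [Prod.mk.injEq, relIdx_inj] at hl
      obtain ⟨rfl, rfl⟩ := hl
      rw [markTuple_val (hN r), forall₂_ofFn] at hl'
      have : (fun i => val (pair a b) (args i)) = t :=
        funext fun i => ((test_mark (hargs i)).1 (hl' i)).symm
      rwa [this]
    · intro h
      refine ⟨_, ⟨r, _, h, rfl⟩, ?_⟩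
      rw [markTuple_val (hN r), forall₂_ofFn]
      exact fun i => (test_mark (hargs i)).2 rfl
  eq x y hx hy := by
    change _ ↔ val (pair a b) x = val (pair a b) y
    constructor
    · rintro (⟨c, rfl, rfl⟩ | ⟨p, ⟨r, t, ht, rfl⟩, z, hz, hxz, hyz⟩)
      · rfl
      · rw [markTuple_val (hN r), List.mem_ofFn] at hz
        obtain ⟨i, rfl⟩ := hz
        exact ((test_mark hx).1 hxz).symm.trans ((test_mark hy).1 hyz)
    · intro h
      have key (hd : val (pair a b) x ∈ L.toDatabase.dom) :
          (recordAtoms (L.record N (encodeNat a) (encodeNat b))).eq x y := by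
        obtain ⟨r, t, ht, i, hi⟩ := hd
        refine .inr ⟨_, ⟨r, t, List.mem_toFinset.1 ht, rfl⟩,
          mark N (encodeNat a) (encodeNat b) (encodeNat (t i)), ?_,
          (test_mark hx).2 hi, (test_mark hy).2 (hi.trans h)⟩
        rw [markTuple_val (hN r), List.mem_ofFn]
        exact ⟨i, rfl⟩
      have hd (z : Bool) : pair a b z ∈ L.toDatabase.dom := by
        cases z
        exacts [ha, hb]
      rcases x with x | c
      · exact key (hd x)
      · rcases y with y | d
        · exact key (h ▸ hd y)
        · obtain rfl : c = d := h
          exact .inl ⟨c, rfl, rfl⟩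

open Classical in
/-- The constraint that a formula poses, computed from the record of a database. -/
noncomputable def Fm.output (φ : Fm R s) (N : ℕ) (acc : Record R.numRel N) : BoolRel :=
  fun p q => decide (φ.Constraint (recordAtoms acc) p q)

/-- Repetitions in `l` are harmless: from a solution indexed by positions, the values at first
occurrences form a solution indexed by elements. -/
theorem solve_matrix (l : List (List Bool)) (f : List Bool → List Bool → BoolRel)
    (hf : ∀ u ∈ l, ∀ w ∈ l, ∀ p q, f u w p q = f w u q p) :
    solve l.length (matrix l f) = true ↔
      ∃ v : List Bool → Bool, ∀ u ∈ l, ∀ w ∈ l, f u w (v u) (v w) = true := by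
  have hm (i) (hi : i < l.length) : l.getD i [] ∈ l := by
    rw [List.getD_eq_getElem _ _ hi]
    exact List.getElem_mem hi
  rw [solve_iff _ (matrix l f) fun i hi j hj => hf _ (hm i hi) _ (hm j hj)]
  constructor
  · rintro ⟨v, hv⟩
    refine ⟨fun u => v (l.idxOf u), fun u hu w hw => ?_⟩
    have h (u) (hu : u ∈ l) : l.getD (l.idxOf u) [] = u := by
      rw [List.getD_eq_getElem _ _ (List.idxOf_lt_length_of_mem hu), List.getElem_idxOf]
    have := hv _ (List.idxOf_lt_length_of_mem hu) _ (List.idxOf_lt_length_of_mem hw)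
    rwa [matrix, h u hu, h w hw] at this
  · rintro ⟨v, hv⟩
    exact ⟨fun i => v (l.getD i []), fun i hi j hj => hv _ (hm i hi) _ (hm j hj)⟩

theorem solve_record (φ : Fm R s) (L : Listing R) (hN : ∀ r, R.arity r ≤ N) (hφ : φ.IsShort N) :
    solve (nums L.toks).length
      (matrix (nums L.toks).reverse ((recorder R.numRel N (φ.output N)).entry L.toks)) = true ↔
    ∃ v : Const → Bool, ∀ a ∈ L.toDatabase.dom, ∀ b ∈ L.toDatabase.dom,
      φ.Constraint (L.toDatabase.atoms (pair a b)) (v a) (v b) := by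
  have key (a) (ha : a ∈ L.toDatabase.dom) (b) (hb : b ∈ L.toDatabase.dom) (p q : Bool) :
      (recorder R.numRel N (φ.output N)).entry L.toks (encodeNat a) (encodeNat b) p q = true ↔
        φ.Constraint (L.toDatabase.atoms (pair a b)) p q := by
    rw [← φ.constraint_congr (agree_record L hN ha hb) hφ, entry_recorder]
    exact @decide_eq_true_iff _ (Classical.propDecidable _)
  rw [← List.length_reverse, solve_matrix]
  · simp only [List.mem_reverse, mem_nums_toks]
    constructor
    · rintro ⟨v, hv⟩
      exact ⟨fun a => v (encodeNat a), fun a ha b hb =>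
        (key a ha b hb _ _).1 (hv _ ⟨a, ha, rfl⟩ _ ⟨b, hb, rfl⟩)⟩
    · rintro ⟨v, hv⟩
      refine ⟨fun u => v (decodeNat u), ?_⟩
      rintro _ ⟨a, ha, rfl⟩ _ ⟨b, hb, rfl⟩
      simp only [decode_encodeNat]
      exact (key a ha b hb _ _).2 (hv a ha b hb)
  · simp only [List.mem_reverse, mem_nums_toks]
    rintro _ ⟨a, ha, rfl⟩ _ ⟨b, hb, rfl⟩ p q
    rw [Bool.eq_iff_iff, key a ha b hb, key b hb a ha, φ.constraint_comm]

end Records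

/-! ### The finite machine and its polynomial time bound. -/

instance (S : Type) [Finite S] : Finite (Regs S) :=
  Finite.of_injective
    (fun v : Regs S => (v.x, v.y, v.z, v.e, v.f, v.p, v.q, v.d, v.m₀, v.l₀, v.ans))
    (by rintro ⟨⟩ ⟨⟩ h; simpa using h)

/-- The machine. -/
noncomputable def machine {S : Type} [Finite S] (A : Scanner S) : FinTM2 where
  K := Stack
  k₀ := .inl .inp
  k₁ := .inr (.inr ())
  Γ := StackSym
  Λ := Label
  main := .copyIn
  σ := Regs S
  initialState := ({} : Conf A).regs
  σFin := Fintype.ofFinite _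
  Γk₀Fin := inferInstanceAs (Fintype Γ')
  m := prog A

open Polynomial in
/-- The running time of the machine, as a polynomial. -/
noncomputable def runTimePoly : ℕ[X] :=
  X * (X * (X * (2 * X + 3) + 4 * X + 6) + 4 * X + 6) + 4 * X + 5 +
    (X * (X * (3 * X + 4) + 2 * X + 5) + 1) + (2 * X + X * (X + 1) + 4)

theorem eval_runTimePoly (n : ℕ) : runTimePoly.eval n = runTime n := by
  simp [runTimePoly, runTime, rowTime]

theorem initList_machine {S : Type} [Finite S] (A : Scanner S) (l : List Γ') :
    initList (machine A) l = Conf.cfg (A := A) (some .copyIn) { inp := l } := by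
  have h : (initList (machine A) l).stk = Conf.stk (A := A) { inp := l } := by
    funext k
    rcases k with k | k | k <;> cases k <;> rfl
  exact congrArg (TM2.Cfg.mk _ _) h

theorem haltList_machine {S : Type} [Finite S] (A : Scanner S) (l : List Bool) :
    haltList (machine A) l = Conf.cfg (A := A) none { out := l } := by
  have h : (haltList (machine A) l).stk = Conf.stk (A := A) { out := l } := by
    funext k
    rcases k with k | k | k <;> cases k <;> rfl
  exact congrArg (TM2.Cfg.mk _ _) h

/-- The time bound holds for every finite-state scanner, so only the correctness of the computed
system remains to be shown for a given query. -/
theorem polyTime_of_solve {R : Schema} (ψ : Query R) {S : Type} [Finite S] (A : Scanner S)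
    (h : ∀ L : Listing R,
      solve (nums L.toks).length (matrix (nums L.toks).reverse (A.entry L.toks)) = true ↔
        ψ.Holds L.toDatabase) : ψ.PolyTime := by
  refine ⟨⟨⟨machine A, Equiv.refl _, Equiv.refl _⟩, runTimePoly, fun L => Nonempty.some ?_⟩⟩
  have hL : solve (nums L.toks).length (matrix (nums L.toks).reverse (A.entry L.toks)) =
      ψ.answer L := by
    rw [Bool.eq_iff_iff, h L]
    exact (@decide_eq_true_iff _ (Classical.propDecidable _)).symm
  have hr := reach_all A L.toks
  rw [text_toks, hL, Reach, ← initList_machine, ← haltList_machine, ← eval_runTimePoly] at hr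
  -- The machine's input and output are images of the encodings under identity maps; generalizing
  -- them allows these maps to be substituted away.
  have key (i : List Γ') (o : List Bool) (hi : i = L.encode) (ho : o = [ψ.answer L]) :
      Nonempty (TM2OutputsInTime (machine A) i (some o) (runTimePoly.eval L.encode.length)) := by
    subst hi ho
    exact hr
  exact key _ _ (List.map_id _) (List.map_id _)

end NPAlg

/-- Let `s` be a positive integer, `PHI` a `q`-free expression over `edb(D) ∪ {Q⁽ˢ⁾}`, in which no
constant is an argument of `Q`, and whose attributes are the two names `Y₁`, `Y₂`. Then
`Guess Q⁽ˢ⁾; FAIL = (DOM × DOM) - π_{Y₁,Y₂}(PHI)` can be evaluated in polynomial time in the size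
of the database. -/
theorem mainTheorem4 (R : NPAlg.Schema) (s : ℕ) (hs : 0 < s)
    (U : Finset NPAlg.Attr) (Y₁ Y₂ : NPAlg.Attr) (h₁ : Y₁ ∈ U) (h₂ : Y₂ ∈ U)
    (hne : Y₁ ≠ Y₂) (hU : ∀ a ∈ U, a = Y₁ ∨ a = Y₂)
    (PHI : NPAlg.RAExpr (NPAlg.vocab R (NPAlg.single s)) U)
    (hq : PHI.QFree) (hc : PHI.NoConstArgs (Set.range Sum.inr)) :
    (NPAlg.pairQuery Y₁ Y₂ h₁ h₂ PHI).PolyTime := by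
  obtain ⟨φ, hφ⟩ := NPAlg.exists_fm_holds Y₁ Y₂ h₁ h₂ hne hU PHI hq hc
  obtain ⟨N₁, hN₁⟩ := φ.exists_isShort
  -- With this `N` no recorded tuple is truncated, and every constant of `φ` is short enough to be
  -- recognized.
  let N := N₁ + ∑ r, R.arity r
  have hN (r) : R.arity r ≤ N :=
    (Finset.single_le_sum (fun _ _ => Nat.zero_le _) (Finset.mem_univ r)).trans
      (Nat.le_add_left _ _)
  refine NPAlg.polyTime_of_solve _ (NPAlg.recorder R.numRel N (φ.output N)) fun L => ?_
  rw [NPAlg.solve_record φ L hN (hN₁.mono (Nat.le_add_right _ _)), hφ,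
    NPAlg.exists_ext_iff hs φ]
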